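/- For a Dirichlet character $\chi$ modulo $q$ put $M(\chi)=\max_{t}\bigl|\sum_{1\le n\le t}\chi(n)\bigr|$, the maximum being over all real $t$. There is a function $C(k)$ of the real number $k>0$ alone, satisfying $$C(k)=\exp\bigl(4k\log\log k+k\log\log\log k+O(k)\bigr)\qquad\text{uniformly for } k\ge 3$$ (with an absolute implied constant), such that for every fixed $k>0$, as $q\to\infty$ over all positive integers, $$\frac1{\varphi(q)}\sum_{\substack{\chi \bmod q\\ \chi\ne\chi_0}}M(\chi)^{2k}\le\bigl(C(k)+o(1)\bigr)q^k .$$ Here the sum runs over all nonprincipal Dirichlet characters modulo $q$, and the $o(1)$ term may depend on $k$. -/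

import Mathlib

open Filter Asymptotics

namespace CharacterSums

/-- The character sum `S_χ(t)`, the sum of `χ n` over the positive integers `n ≤ t`. -/
noncomputable def charSum {q : ℕ} (χ : DirichletCharacter ℂ q) (t : ℝ) : ℂ :=
  ∑ n ∈ Finset.Icc 1 ⌊t⌋₊, χ (n : ZMod q)

/-- `M(χ)`, the maximum over all real `t` of `|S_χ(t)|`. The supremum is attained whenever `χ` is
nonprincipal, see `isGreatest_maxCharSum`. -/
noncomputable def maxCharSum {q : ℕ} (χ : DirichletCharacter ℂ q) : ℝ :=
  ⨆ t : ℝ, ‖charSum χ t‖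

lemma charSum_natCast {q : ℕ} [NeZero q] {χ : DirichletCharacter ℂ q} (hχ : χ ≠ 1) (N : ℕ) :
    charSum χ (N : ℝ) = ∑ n ∈ Finset.range (N + 1), χ (n : ZMod q) := by
  have h0 : χ ((0 : ℕ) : ZMod q) = 0 := by
    have hq : q ≠ 1 := by
      rintro rfl
      exact hχ (Subsingleton.elim _ _)
    have : Nontrivial (ZMod q) := ZMod.nontrivial_iff.2 hq
    simpa using χ.map_nonunit not_isUnit_zero
  rw [charSum, Nat.floor_natCast, Finset.sum_range_succ', h0, add_zero,
    Finset.range_eq_Ico, Finset.sum_Ico_add' (fun n : ℕ => χ (n : ZMod q)) 0 N 1]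
  rfl

lemma charSum_add_period {q : ℕ} [NeZero q] {χ : DirichletCharacter ℂ q} (hχ : χ ≠ 1) (N : ℕ) :
    charSum χ ((q + N : ℕ) : ℝ) = charSum χ (N : ℝ) := by
  have hper : ∑ n ∈ Finset.range q, χ (n : ZMod q) = 0 := by
    rw [← MulChar.sum_eq_zero_of_ne_one hχ]
    refine Finset.sum_bij' (fun n _ => (n : ZMod q)) (fun a _ => a.val) ?_ ?_ ?_ ?_ ?_
    · simp
    · intro a _
      exact Finset.mem_range.2 a.val_lt
    · intro n hn
      exact ZMod.val_cast_of_lt (Finset.mem_range.1 hn)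
    · intro a _
      exact ZMod.natCast_zmod_val a
    · simp
  rw [charSum_natCast hχ, charSum_natCast hχ, add_assoc, Finset.sum_range_add, hper, zero_add]
  simp

/-- For a nonprincipal character, `M(χ)` is a genuine maximum. -/
theorem isGreatest_maxCharSum {q : ℕ} [NeZero q] {χ : DirichletCharacter ℂ q} (hχ : χ ≠ 1) :
    IsGreatest (Set.range fun t : ℝ => ‖charSum χ t‖) (maxCharSum χ) := by
  have hfin : (Set.range fun t : ℝ => ‖charSum χ t‖).Finite := by
    refine ((Finset.range q).finite_toSet.image fun N : ℕ => ‖charSum χ (N : ℝ)‖).subset ?_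
    rintro _ ⟨t, rfl⟩
    refine ⟨⌊t⌋₊ % q, by simpa using Nat.mod_lt _ (NeZero.pos q), ?_⟩
    have key : ∀ m r : ℕ, charSum χ ((q * m + r : ℕ) : ℝ) = charSum χ (r : ℝ) := by
      intro m r
      induction m with
      | zero => simp
      | succ m ih =>
        rw [show q * (m + 1) + r = q + (q * m + r) by ring, charSum_add_period hχ, ih]
    have h := key (⌊t⌋₊ / q) (⌊t⌋₊ % q)
    rw [Nat.div_add_mod] at h
    have h' : charSum χ (⌊t⌋₊ : ℝ) = charSum χ t := by simp [charSum]
    simp only [← h, h']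
  have := (Set.range_nonempty fun t : ℝ => ‖charSum χ t‖).csSup_mem hfin
  exact ⟨this, fun x hx => le_csSup hfin.bddAbove hx⟩

open scoped Classical in
/-- The `2k`-th moment `φ(q)⁻¹ ∑_{χ ≠ χ₀} M(χ)^{2k}` over the nonprincipal characters mod `q`. -/
noncomputable def moment (q : ℕ) (k : ℝ) : ℝ :=
  1 / (q.totient : ℝ) *
    ∑ χ : DirichletCharacter ℂ q with χ ≠ 1, maxCharSum χ ^ (2 * k)

end CharacterSums

namespace CharacterSums

/-! ### Minkowski's inequality for moments -/

/-! For primitive `χ`, completing the sum with Gauss sums expresses `charSum χ⁻¹ t` through the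
frequencies `m / q`. Averaging the starting point of the interval over about `√q` shifts makes the
Fourier weights decay like `m⁻²` beyond `√q`. So `norm_charSum_inv_le` bounds the maximum by `√q`
times a constant plus four sums of `w m * expi (m * θ) * χ m` over `m ≤ Y`, with `Y` of order `√q`
and `‖w m‖ ≤ 1 / m`. Here `θ` depends on `χ` through the point where the maximum is attained.

To bound the `2K`-th moment of such a sum (`sum_norm_logWeight_pow_le`), write `m = a * b` with `a`
being `K ^ 32`-smooth and `b` being `K ^ 32`-rough. The smooth part is treated trivially and costs
`∑ 1 / a ≪ log² K`; this is the entire main term, since `(log² k) ^ (2k)` is `exp (4k log log k)`.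
The rough part contributes `O(1)`. It is cut into blocks `[4 ^ j, 4 ^ (j + 1))`; on each, `θ` is
rounded to a grid of `8 ^ j` points, and one sums over the whole grid to remove the dependence on
`χ`. For fixed `θ`, orthogonality bounds the moments, because a rough number `m` has at most `m ^ (1
/ 32)` factorizations into `K` factors. The saving beats the factor `8 ^ j` precisely because `4 ^
j` stays below a multiple of `√q`. Minkowski's inequality adds up the pieces.

An imprimitive character costs a divisor factor (`maxCharSum_changeLevel_le`), which is harmless
when summed over conductors. Hölder's inequality (`exists_moment_le`) passes from moments of order
`4L` to real `k`.

The resulting bound is `exp (4k log log k + O(k))`. The term `k log log log k` is bounded below by a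
constant multiple of `k` for `k ≥ 3`, so it can be included at the expense of the `O(k)`. -/

lemma sum_add_pow_le {ι : Type*} (s : Finset ι) {f g : ι → ℝ} {n : ℕ} (hn : n ≠ 0) {W u v : ℝ}
    (hW : 0 ≤ W) (hu : 0 ≤ u) (hv : 0 ≤ v) (hf : ∀ i ∈ s, 0 ≤ f i) (hg : ∀ i ∈ s, 0 ≤ g i)
    (hfu : ∑ i ∈ s, f i ^ n ≤ W * u ^ n) (hgv : ∑ i ∈ s, g i ^ n ≤ W * v ^ n) :
    ∑ i ∈ s, (f i + g i) ^ n ≤ W * (u + v) ^ n := by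
  have hn1 : (1 : ℝ) ≤ n := by exact_mod_cast Nat.one_le_iff_ne_zero.2 hn
  have hn0 : (0 : ℝ) < n := by linarith
  have key : ∀ {h : ι → ℝ} {w : ℝ}, 0 ≤ w → (∀ i ∈ s, 0 ≤ h i) → ∑ i ∈ s, h i ^ n ≤ W * w ^ n →
      (∑ i ∈ s, h i ^ (n : ℝ)) ^ (1 / (n : ℝ)) ≤ W ^ (1 / (n : ℝ)) * w := by
    intro h w hw hh hle
    simp only [Real.rpow_natCast]
    calc (∑ i ∈ s, h i ^ n) ^ (1 / (n : ℝ)) ≤ (W * w ^ n) ^ (1 / (n : ℝ)) :=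
          Real.rpow_le_rpow (Finset.sum_nonneg fun i hi => pow_nonneg (hh i hi) n) hle (by positivity)
      _ = W ^ (1 / (n : ℝ)) * w := by
          rw [Real.mul_rpow hW (by positivity), one_div, Real.pow_rpow_inv_natCast hw hn]
  have h := (Real.Lp_add_le_of_nonneg s hn1 hf hg).trans
    (add_le_add (key hu hf hfu) (key hv hg hgv))
  rw [← mul_add] at h
  simp only [Real.rpow_natCast] at h
  have h0 : 0 ≤ ∑ i ∈ s, (f i + g i) ^ n :=
    Finset.sum_nonneg fun i hi => pow_nonneg (add_nonneg (hf i hi) (hg i hi)) n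
  have h2 := pow_le_pow_left₀ (by positivity) h n
  rw [one_div, Real.rpow_inv_natCast_pow h0 hn, mul_pow, Real.rpow_inv_natCast_pow hW hn] at h2
  exact h2

lemma sum_sum_pow_le {ι κ : Type*} (s : Finset ι) (t : Finset κ) {f : κ → ι → ℝ} {n : ℕ}
    (hn : n ≠ 0) {W : ℝ} {u : κ → ℝ} (hW : 0 ≤ W) (hu : ∀ j ∈ t, 0 ≤ u j)
    (hf : ∀ j ∈ t, ∀ i ∈ s, 0 ≤ f j i) (hfu : ∀ j ∈ t, ∑ i ∈ s, f j i ^ n ≤ W * u j ^ n) :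
    ∑ i ∈ s, (∑ j ∈ t, f j i) ^ n ≤ W * (∑ j ∈ t, u j) ^ n := by
  classical
  induction t using Finset.induction_on with
  | empty => simp [hn]
  | insert j t hj ih =>
    simp only [Finset.sum_insert hj]
    simp only [Finset.forall_mem_insert] at hu hf hfu
    exact sum_add_pow_le s hn hW hu.1 (Finset.sum_nonneg hu.2) hf.1
      (fun i hi => Finset.sum_nonneg fun k hk => hf.2 k hk i hi) hfu.1 (ih hu.2 hf.2 hfu.2)

/-! ### Reciprocals of smooth numbers -/

/-- Apply `log x ≥ 1 - 1 / x` twice, to `log (N + 1) / log N` and to `(N + 1) / N`. -/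
lemma inv_le_log_log_succ_sub {N : ℕ} (hN : 2 ≤ N) :
    1 / (((N + 1 : ℕ) : ℝ) * Real.log (N + 1 : ℕ)) ≤
      Real.log (Real.log (N + 1 : ℕ)) - Real.log (Real.log N) := by
  have hN' : (2 : ℝ) ≤ N := by exact_mod_cast hN
  have hL : 0 < Real.log N := Real.log_pos (by linarith)
  have hL' : 0 < Real.log (N + 1 : ℕ) := Real.log_pos (by push_cast; linarith)
  rw [← Real.log_div hL'.ne' hL.ne']
  have h1 := Real.one_sub_inv_le_log_of_pos (div_pos hL' hL)
  refine le_trans ?_ h1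
  have h2 := Real.one_sub_inv_le_log_of_pos (x := ((N + 1 : ℕ) : ℝ) / N) (by positivity)
  rw [Real.log_div (by positivity) (by positivity)] at h2
  have h3 : 1 / ((N + 1 : ℕ) : ℝ) ≤ Real.log (N + 1 : ℕ) - Real.log N := by
    refine le_trans (le_of_eq ?_) h2
    push_cast
    field_simp
    ring
  rw [inv_div, one_sub_div hL'.ne', ← one_div_mul_one_div, mul_one_div]
  gcongr

/-- Partial summation from Chebyshev's bound `θ(N) ≤ N log 4`, run as an induction. The last
subtracted term is the boundary term of the Abel summation; it is what makes the induction close,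
and it is nonnegative, hence dropped later. -/
lemma sum_inv_prime_le_aux {N : ℕ} (hN : 2 ≤ N) :
    ∑ n ∈ Finset.range (N + 1), (if n.Prime then 1 / (n : ℝ) else 0) ≤
      Real.log 4 * Real.log (Real.log N) + (1 / Real.log 2 + 2 - Real.log 4 * Real.log (Real.log 2))
        - (Real.log 4 * N - Chebyshev.theta N) / (N * Real.log N) := by
  induction N, hN using Nat.le_induction with
  | base =>
    have ht : Chebyshev.theta (2 : ℕ) = Real.log 2 := by
      rw [Chebyshev.theta_eq_sum_primesLE_log]
      have : Nat.primesLE 2 = {2} := by decide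
      simp [this]
    rw [ht]
    have h4 : Real.log 4 = 2 * Real.log 2 := by
      rw [show (4 : ℝ) = 2 ^ 2 by norm_num, Real.log_pow]; norm_num
    have hl : 0 < Real.log 2 := Real.log_pos (by norm_num)
    rw [h4]
    norm_num [Finset.sum_range_succ, Nat.prime_two]
    have : (2 * Real.log 2 * 2 - Real.log 2) / (2 * Real.log 2) = 3 / 2 := by field_simp; norm_num
    rw [this]
    have : 0 < (Real.log 2)⁻¹ := by positivity
    linarith
  | succ N hN ih =>
    rw [Finset.sum_range_succ]
    have hN' : (2 : ℝ) ≤ N := by exact_mod_cast hN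
    have hL : 0 < Real.log N := Real.log_pos (by linarith)
    have hL' : 0 < Real.log (N + 1 : ℕ) := Real.log_pos (by push_cast; linarith)
    have hth : Chebyshev.theta (N + 1 : ℕ) = Chebyshev.theta N +
        (if (N + 1).Prime then Real.log (N + 1 : ℕ) else 0) := by
      rw [Chebyshev.theta_eq_sum_primesLE_log, Chebyshev.theta_eq_sum_primesLE_log,
        Nat.primesLE, Nat.primesLE, Nat.primesBelow, Nat.primesBelow, Finset.sum_filter,
        Finset.sum_filter, Finset.sum_range_succ]
    have hstep : (if (N + 1).Prime then 1 / ((N + 1 : ℕ) : ℝ) else 0) =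
        (Chebyshev.theta (N + 1 : ℕ) - Chebyshev.theta N) *
          (1 / (((N + 1 : ℕ) : ℝ) * Real.log (N + 1 : ℕ))) := by
      rw [hth]
      split_ifs
      · field_simp; ring
      · simp
    have hle := Chebyshev.theta_le_log4_mul_x (x := N) (by positivity)
    have hanti : 1 / (((N + 1 : ℕ) : ℝ) * Real.log (N + 1 : ℕ)) ≤ 1 / (N * Real.log N) := by
      gcongr <;> omega
    have hloglog := inv_le_log_log_succ_sub hN
    set g' := 1 / (((N + 1 : ℕ) : ℝ) * Real.log (N + 1 : ℕ)) with hg'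
    set g := 1 / ((N : ℝ) * Real.log N) with hg
    rw [hstep]
    rw [← mul_one_div (_ - _) (_ * _), ← hg] at ih
    rw [← mul_one_div (_ - _) (_ * _), ← hg']
    have h4 : 0 < Real.log 4 := Real.log_pos (by norm_num)
    have e1 : 0 ≤ (Real.log 4 * N - Chebyshev.theta N) * (g - g') :=
      mul_nonneg (by linarith) (by linarith)
    have e2 := mul_le_mul_of_nonneg_left hloglog h4.le
    push_cast at *
    linarith

lemma sum_inv_mul_sub_one_le (N : ℕ) :
    ∑ n ∈ Finset.range (N + 1), (if n.Prime then 1 / ((n : ℝ) * (n - 1)) else 0) ≤ 1 := by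
  suffices h : ∀ N : ℕ, 1 ≤ N →
      ∑ n ∈ Finset.range (N + 1), (if n.Prime then 1 / ((n : ℝ) * (n - 1)) else 0) ≤ 1 - 1 / N by
    rcases Nat.eq_zero_or_pos N with rfl | hN
    · simp
    · have := h N hN
      have : (0 : ℝ) ≤ 1 / N := by positivity
      linarith
  intro N hN
  induction N, hN using Nat.le_induction with
  | base => norm_num [Finset.sum_range_succ]
  | succ N hN ih =>
    rw [Finset.sum_range_succ]
    have hN' : (0 : ℝ) < N := by exact_mod_cast hN
    have : (if (N + 1).Prime then 1 / (((N + 1 : ℕ) : ℝ) * (((N + 1 : ℕ) : ℝ) - 1)) else 0) ≤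
        1 / (N : ℝ) - 1 / (N + 1 : ℕ) := by
      have e : 1 / (N : ℝ) - 1 / (N + 1 : ℕ) =
          1 / (((N + 1 : ℕ) : ℝ) * (((N + 1 : ℕ) : ℝ) - 1)) := by
        push_cast; rw [add_sub_cancel_right]; field_simp; ring
      rw [e]
      split_ifs
      · rfl
      · push_cast; simp; positivity
    linarith

/-- The sum of reciprocals of the `y`-smooth numbers is at most a constant times `log² y`. -/
lemma exists_sum_inv_smoothNumbers_le : ∃ C : ℝ, 0 < C ∧ ∀ y : ℕ, 3 ≤ y → ∀ s : Finset ℕ,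
    (∀ a ∈ s, a ∈ Nat.smoothNumbers y) → ∑ a ∈ s, 1 / (a : ℝ) ≤ C * Real.log y ^ 2 := by
  set D : ℝ := 1 / Real.log 2 + 2 - Real.log 4 * Real.log (Real.log 2) with hD
  refine ⟨Real.exp (D + 1), Real.exp_pos _, fun y hy s hs => ?_⟩
  let f : ℕ →* ℝ :=
    { toFun := fun n => 1 / (n : ℝ), map_one' := by simp, map_mul' := fun a b => by
        push_cast; rw [one_div_mul_one_div] }
  obtain ⟨hsum, hprod⟩ := EulerProduct.summable_and_hasSum_smoothNumbers_prod_primesBelow_geometric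
    (f := f) (fun {p} hp => by
      change ‖1 / (p : ℝ)‖ < 1
      rw [Real.norm_of_nonneg (by positivity), div_lt_one (by exact_mod_cast hp.pos)]
      exact_mod_cast hp.one_lt) y
  have hy' : (3 : ℝ) ≤ y := by exact_mod_cast hy
  have hlog1 : 1 < Real.log y := by
    rw [Real.lt_log_iff_exp_lt (by linarith)]
    linarith [Real.exp_one_lt_three]
  have h1 : ∑ a ∈ s, 1 / (a : ℝ) ≤ ∏ p ∈ y.primesBelow, (1 - f p)⁻¹ := by
    have := hprod.summable.sum_le_tsum (s.subtype (· ∈ Nat.smoothNumbers y))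
      (fun i _ => by change (0 : ℝ) ≤ 1 / ((i : ℕ) : ℝ); positivity)
    rw [hprod.tsum_eq, Finset.sum_subtype_of_mem (fun a => f a) hs] at this
    exact this
  have h2 : ∏ p ∈ y.primesBelow, (1 - f p)⁻¹ ≤
      Real.exp (∑ p ∈ y.primesBelow, (1 / (p : ℝ) + 1 / ((p : ℝ) * (p - 1)))) := by
    rw [Real.exp_sum]
    refine Finset.prod_le_prod (fun p hp => ?_) (fun p hp => ?_)
    · have hp := Nat.prime_of_mem_primesBelow hp
      have : (2 : ℝ) ≤ p := by exact_mod_cast hp.two_le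
      change 0 ≤ (1 - 1 / (p : ℝ))⁻¹
      rw [inv_nonneg, sub_nonneg, div_le_one (by linarith)]
      linarith
    · have hp := Nat.prime_of_mem_primesBelow hp
      have h2 : (2 : ℝ) ≤ p := by exact_mod_cast hp.two_le
      have h3 : (0 : ℝ) < p - 1 := by linarith
      change (1 - 1 / (p : ℝ))⁻¹ ≤ _
      -- Exactly, `(1 - 1 / p)⁻¹ = 1 + 1 / p + 1 / (p * (p - 1))`.
      refine le_trans (le_of_eq ?_) (Real.add_one_le_exp _)
      field_simp
      ring
  have h3 : ∑ p ∈ y.primesBelow, (1 / (p : ℝ) + 1 / ((p : ℝ) * (p - 1))) ≤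
      2 * Real.log (Real.log y) + (D + 1) := by
    obtain ⟨N, rfl⟩ : ∃ N, y = N + 1 := ⟨y - 1, by omega⟩
    have hN : 2 ≤ N := by omega
    have hN' : (2 : ℝ) ≤ N := by exact_mod_cast hN
    have a1 := sum_inv_prime_le_aux hN
    have a2 := sum_inv_mul_sub_one_le N
    have hL : 0 < Real.log N := Real.log_pos (by linarith)
    have a3 : 0 ≤ (Real.log 4 * N - Chebyshev.theta N) / (N * Real.log N) :=
      div_nonneg (by linarith [Chebyshev.theta_le_log4_mul_x (x := N) (by positivity)])
        (by positivity)
    have a4 : Real.log (Real.log N) ≤ Real.log (Real.log (N + 1 : ℕ)) :=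
      Real.log_le_log hL (Real.log_le_log (by linarith) (by push_cast; linarith))
    -- Rounding the Chebyshev constant up to 2 gives the exponent in `log² y`, which is all the
    -- theorem requires.
    have a5 : Real.log 4 ≤ 2 := by
      rw [show (4 : ℝ) = 2 ^ 2 by norm_num, Real.log_pow]
      have := Real.log_two_lt_d9
      push_cast; linarith
    have a6 : 0 ≤ Real.log (Real.log (N + 1 : ℕ)) := Real.log_nonneg hlog1.le
    have a7 : 0 ≤ Real.log 4 := Real.log_nonneg (by norm_num)
    have a8 := mul_le_mul_of_nonneg_left a4 a7
    have a9 := mul_le_mul_of_nonneg_right a5 a6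
    rw [Finset.sum_add_distrib, Nat.primesBelow, Finset.sum_filter, Finset.sum_filter]
    linarith
  calc ∑ a ∈ s, 1 / (a : ℝ) ≤ Real.exp (2 * Real.log (Real.log y) + (D + 1)) :=
        h1.trans (h2.trans (Real.exp_le_exp.2 h3))
    _ = Real.exp (D + 1) * Real.log y ^ 2 := by
        rw [Real.exp_add, mul_comm, two_mul, Real.exp_add (Real.log _), Real.exp_log (by linarith), sq]

/-! ### The divisor function -/

lemma add_one_pow_four_le (v : ℕ) : (v + 1) ^ 4 ≤ 256 * 2 ^ v := by
  have h1 : v + 1 ≤ 4 * 2 ^ (v / 4) := by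
    have := Nat.lt_two_pow_self (n := v / 4)
    omega
  calc (v + 1) ^ 4 ≤ (4 * 2 ^ (v / 4)) ^ 4 := Nat.pow_le_pow_left h1 4
    _ = 256 * 2 ^ (v / 4 * 4) := by rw [mul_pow, ← pow_mul]; norm_num
    _ ≤ 256 * 2 ^ v := by gcongr <;> omega

/-- Compare prime by prime: for `p ≥ 16`, `(v + 1) ^ 4 ≤ 16 ^ v ≤ p ^ v`, while each of the at most
16 smaller primes loses a factor 256. -/
lemma card_divisors_pow_four_le {n : ℕ} (hn : n ≠ 0) :
    n.divisors.card ^ 4 ≤ 256 ^ 16 * n := by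
  rw [Nat.card_divisors hn, ← Finset.prod_pow]
  calc ∏ p ∈ n.primeFactors, (n.factorization p + 1) ^ 4
      ≤ ∏ p ∈ n.primeFactors, ((if p < 16 then 256 else 1) * p ^ n.factorization p) := by
        refine Finset.prod_le_prod' fun p hp => ?_
        have hp2 := (Nat.prime_of_mem_primeFactors hp).two_le
        split_ifs with h
        · exact (add_one_pow_four_le _).trans (by gcongr)
        · rw [one_mul]
          calc (n.factorization p + 1) ^ 4 ≤ (2 ^ n.factorization p) ^ 4 :=
                Nat.pow_le_pow_left Nat.lt_two_pow_self 4
            _ = 16 ^ n.factorization p := by rw [← pow_mul, mul_comm, pow_mul]; norm_num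
            _ ≤ p ^ n.factorization p := by gcongr; omega
    _ = (∏ p ∈ n.primeFactors, if p < 16 then 256 else 1) * n := by
        rw [Finset.prod_mul_distrib]
        congr 1
        exact Nat.prod_factorization_pow_eq_self hn
    _ ≤ 256 ^ 16 * n := by
        gcongr
        rw [← Finset.prod_filter, Finset.prod_const]
        refine Nat.pow_le_pow_right (by norm_num) ?_
        calc _ ≤ (Finset.range 16).card := Finset.card_le_card fun p hp => by
              simpa using (Finset.mem_filter.1 hp).2
          _ = 16 := Finset.card_range 16

/-! ### Mean values of Dirichlet polynomials -/

lemma star_dirichletCharacter_apply {q : ℕ} [NeZero q] (χ : DirichletCharacter ℂ q) (a : ZMod q) :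
    (starRingEnd ℂ) (χ a) = χ⁻¹ a := by
  exact MulChar.star_apply' χ a

open scoped Classical in
lemma norm_sum_char_mul_star_le {q : ℕ} [NeZero q] (a b : ZMod q) :
    ‖∑ χ : DirichletCharacter ℂ q, χ a * (starRingEnd ℂ) (χ b)‖ ≤
      if a = b then (q.totient : ℝ) else 0 := by
  by_cases hb : IsUnit b
  · obtain ⟨u, rfl⟩ := hb
    have h := DirichletCharacter.sum_char_inv_mul_char_eq ℂ u.isUnit a
    have : ∑ χ : DirichletCharacter ℂ q, χ a * (starRingEnd ℂ) (χ u) =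
        if (u : ZMod q) = a then (q.totient : ℂ) else 0 := by
      rw [← h]
      refine Finset.sum_congr rfl fun χ _ => ?_
      rw [star_dirichletCharacter_apply, MulChar.inv_apply, Ring.inverse_unit, ZMod.inv_coe_unit,
        mul_comm]
    rw [this]
    simp only [eq_comm (a := (u : ZMod q))]
    split_ifs <;> simp
  · have : ∑ χ : DirichletCharacter ℂ q, χ a * (starRingEnd ℂ) (χ b) = 0 :=
      Finset.sum_eq_zero fun χ _ => by rw [χ.map_nonunit hb]; simp
    rw [this]
    split_ifs <;> simp

lemma card_filter_natCast_eq_le {q : ℕ} [NeZero q] (X m : ℕ) :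
    (((Finset.range X).filter fun n : ℕ => (m : ZMod q) = n).card : ℝ) ≤ X / q + 1 := by
  have h := Nat.count_modEq_card X (NeZero.pos q) m
  have h1 : ((Finset.range X).filter fun n : ℕ => (m : ZMod q) = n).card =
      Nat.count (· ≡ m [MOD q]) X := by
    rw [Nat.count_eq_card_filter_range]
    congr 1
    refine Finset.filter_congr fun n _ => ?_
    rw [← ZMod.natCast_eq_natCast_iff, eq_comm]
  rw [h1, h]
  have h2 : ((X / q : ℕ) : ℝ) ≤ X / q := Nat.cast_div_le
  split_ifs <;> push_cast <;> linarith

/-- Orthogonality leaves the pairs `m ≡ n` modulo `q`; then `2‖c m‖‖c n‖ ≤ ‖c m‖² + ‖c n‖²`, and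
each residue class meets `range X` at most `X / q + 1` times. -/
lemma sum_norm_sq_le {q : ℕ} [NeZero q] (X : ℕ) (c : ℕ → ℂ) :
    ∑ χ : DirichletCharacter ℂ q, ‖∑ m ∈ Finset.range X, c m * χ m‖ ^ 2 ≤
      q.totient * ((X / q + 1) * ∑ m ∈ Finset.range X, ‖c m‖ ^ 2) := by
  classical
  have hexp : ((∑ χ : DirichletCharacter ℂ q, ‖∑ m ∈ Finset.range X, c m * χ m‖ ^ 2 : ℝ) : ℂ) =
      ∑ m ∈ Finset.range X, ∑ n ∈ Finset.range X, c m * (starRingEnd ℂ) (c n) *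
        ∑ χ : DirichletCharacter ℂ q, χ m * (starRingEnd ℂ) (χ n) := by
    push_cast
    simp_rw [← Complex.mul_conj', map_sum, Finset.sum_mul_sum, map_mul, Finset.mul_sum]
    rw [Finset.sum_comm]
    refine Finset.sum_congr rfl fun m _ => ?_
    rw [Finset.sum_comm]
    refine Finset.sum_congr rfl fun n _ => Finset.sum_congr rfl fun χ _ => by ring
  have h1 : ∑ χ : DirichletCharacter ℂ q, ‖∑ m ∈ Finset.range X, c m * χ m‖ ^ 2 ≤
      ∑ m ∈ Finset.range X, ∑ n ∈ Finset.range X, ‖c m‖ * ‖c n‖ *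
        (if (m : ZMod q) = n then (q.totient : ℝ) else 0) := by
    rw [← Complex.norm_of_nonneg (r := ∑ χ : DirichletCharacter ℂ q, _)
      (Finset.sum_nonneg fun χ _ => sq_nonneg _), hexp]
    refine (norm_sum_le _ _).trans (Finset.sum_le_sum fun m _ => (norm_sum_le _ _).trans
      (Finset.sum_le_sum fun n _ => ?_))
    rw [norm_mul, norm_mul, RCLike.norm_conj]
    exact mul_le_mul_of_nonneg_left (norm_sum_char_mul_star_le _ _) (by positivity)
  have h2 : ∀ m n : ℕ, ‖c m‖ * ‖c n‖ * (if (m : ZMod q) = n then (q.totient : ℝ) else 0) ≤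
      (if (m : ZMod q) = n then (q.totient : ℝ) * ‖c m‖ ^ 2 / 2 else 0) +
      (if (n : ZMod q) = m then (q.totient : ℝ) * ‖c n‖ ^ 2 / 2 else 0) := by
    intro m n
    simp only [eq_comm (a := (n : ZMod q))]
    split_ifs
    · have := mul_nonneg (Nat.cast_nonneg (α := ℝ) q.totient) (sq_nonneg (‖c m‖ - ‖c n‖))
      nlinarith
    · simp
  refine h1.trans ((Finset.sum_le_sum fun m _ => Finset.sum_le_sum fun n _ => h2 m n).trans ?_)
  have h3 : ∑ m ∈ Finset.range X, ∑ n ∈ Finset.range X,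
      (if (m : ZMod q) = n then (q.totient : ℝ) * ‖c m‖ ^ 2 / 2 else 0) ≤
      q.totient * ((X / q + 1) * ∑ m ∈ Finset.range X, ‖c m‖ ^ 2) / 2 := by
    rw [Finset.mul_sum, Finset.mul_sum, Finset.sum_div]
    refine Finset.sum_le_sum fun m _ => ?_
    rw [← Finset.sum_filter, Finset.sum_const, nsmul_eq_mul]
    have := mul_le_mul_of_nonneg_right (card_filter_natCast_eq_le (q := q) X m)
      (show 0 ≤ (q.totient : ℝ) * ‖c m‖ ^ 2 / 2 by positivity)
    linarith
  simp_rw [Finset.sum_add_distrib]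
  rw [Finset.sum_comm (f := fun m n : ℕ =>
    if (n : ZMod q) = m then (q.totient : ℝ) * ‖c n‖ ^ 2 / 2 else 0)]
  linarith

/-- The number of ordered factorizations of `m` into `l` factors is at most `l ^ Ω(m)`. -/
lemma card_finMulAntidiag_le (l : ℕ) {m : ℕ} (hm : m ≠ 0) :
    (Nat.finMulAntidiag l m).card ≤ l ^ ArithmeticFunction.cardFactors m := by
  induction m using induction_on_primes with
  | zero => exact absurd rfl hm
  | one => simp [Nat.finMulAntidiag_one]
  | prime_mul p a hp ih =>
    have ha : a ≠ 0 := right_ne_zero_of_mul hm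
    rw [ArithmeticFunction.cardFactors_mul hp.ne_zero ha,
      ArithmeticFunction.cardFactors_apply_prime hp, pow_add, pow_one]
    -- Every factorization of `p * a` arises from one of `a` by multiplying one of the `l` entries
    -- by `p`.
    calc (Nat.finMulAntidiag l (p * a)).card
        ≤ (((Finset.univ : Finset (Fin l)) ×ˢ Nat.finMulAntidiag l a).image
            fun x => Function.update x.2 x.1 (p * x.2 x.1)).card := by
          refine Finset.card_le_card fun f hf => ?_
          obtain ⟨hf, -⟩ := Nat.mem_finMulAntidiag.1 hf
          obtain ⟨i, -, hi⟩ := (Nat.Prime.prime hp).exists_mem_finset_dvd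
            (hf ▸ dvd_mul_right p a : p ∣ ∏ i, f i)
          obtain ⟨g, hg⟩ := hi
          refine Finset.mem_image.2 ⟨(i, Function.update f i g), ?_, ?_⟩
          · simp only [Finset.mem_product, Finset.mem_univ, true_and, Nat.mem_finMulAntidiag]
            refine ⟨?_, ha⟩
            refine Nat.eq_of_mul_eq_mul_left hp.pos ?_
            rw [← hf, Finset.prod_update_of_mem (Finset.mem_univ i), ← mul_assoc, ← hg,
              ← Finset.prod_sdiff (Finset.subset_univ {i}), mul_comm]
            simp
          · simp [← hg]
      _ ≤ _ := Finset.card_image_le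
      _ ≤ l * l ^ ArithmeticFunction.cardFactors a := by
          rw [Finset.card_product, Finset.card_univ, Fintype.card_fin]
          exact Nat.mul_le_mul_left l (ih ha)

/-- If all prime factors of `m` are at least `y`, then `y ^ Ω(m) ≤ m`. -/
lemma pow_cardFactors_le {y m : ℕ} (hm : m ≠ 0) (hy : ∀ p, p.Prime → p ∣ m → y ≤ p) :
    y ^ ArithmeticFunction.cardFactors m ≤ m := by
  rw [ArithmeticFunction.cardFactors_apply]
  conv_rhs => rw [← Nat.prod_primeFactorsList hm]
  refine List.pow_card_le_prod _ _ fun p hp => ?_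
  exact hy p (Nat.prime_of_mem_primeFactorsList hp) (Nat.dvd_of_mem_primeFactorsList hp)

lemma card_finMulAntidiag_pow_le {K l m : ℕ} (hl : l ≤ K) (hm : m ≠ 0)
    (hy : ∀ p, p.Prime → p ∣ m → K ^ 32 ≤ p) : (Nat.finMulAntidiag l m).card ^ 32 ≤ m :=
  calc (Nat.finMulAntidiag l m).card ^ 32 ≤ (K ^ ArithmeticFunction.cardFactors m) ^ 32 :=
        Nat.pow_le_pow_left ((card_finMulAntidiag_le l hm).trans (Nat.pow_le_pow_left hl _)) 32
    _ = (K ^ 32) ^ ArithmeticFunction.cardFactors m := by rw [← pow_mul, ← pow_mul, mul_comm]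
    _ ≤ m := pow_cardFactors_le hm hy

/-- The `l`-th power is a Dirichlet polynomial of length `N ^ l`, to which the mean square bound
applies. Its coefficients are at most `A ^ l` times a number of representations. In the square of
that number one factor is bounded by `ρ`, and the other sums to `S.card ^ l`. -/
lemma sum_norm_pow_le {q : ℕ} [NeZero q] (S : Finset ℕ) (c : ℕ → ℂ) (l N : ℕ) (hN : 0 < N)
    (hl : l ≠ 0) {A ρ : ℝ}
    (hS : ∀ b ∈ S, b ≠ 0 ∧ b < N) (hA : 0 ≤ A) (hc : ∀ b ∈ S, ‖c b‖ ≤ A) (hρ : 0 ≤ ρ)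
    (hr : ∀ f : Fin l → ℕ, (∀ i, f i ∈ S) → ((Nat.finMulAntidiag l (∏ i, f i)).card : ℝ) ≤ ρ) :
    ∑ χ : DirichletCharacter ℂ q, ‖∑ b ∈ S, c b * χ b‖ ^ (2 * l) ≤
      q.totient * (((N ^ l : ℕ) / q + 1) * (A ^ (2 * l) * ρ * S.card ^ l)) := by
  classical
  let P := Fintype.piFinset fun _ : Fin l => S
  let F : ℕ → Finset (Fin l → ℕ) := fun m => P.filter fun f => ∏ i, f i = m
  let C : ℕ → ℂ := fun m => ∑ f ∈ F m, ∏ i, c (f i)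
  have hP : ∀ f ∈ P, ∀ i, f i ∈ S := fun f hf => Fintype.mem_piFinset.1 hf
  have hmaps : ∀ f ∈ P, ∏ i, f i ∈ Finset.range (N ^ l) := by
    intro f hf
    rw [Finset.mem_range]
    have : Nonempty (Fin l) := ⟨⟨0, Nat.pos_of_ne_zero hl⟩⟩
    calc ∏ i, f i < ∏ i : Fin l, N := Finset.prod_lt_prod_of_nonempty
          (fun i _ => Nat.pos_of_ne_zero (hS _ (hP f hf i)).1) (fun i _ => (hS _ (hP f hf i)).2)
          Finset.univ_nonempty
      _ = N ^ l := by simp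
  have hpow : ∀ χ : DirichletCharacter ℂ q,
      (∑ b ∈ S, c b * χ b) ^ l = ∑ m ∈ Finset.range (N ^ l), C m * χ m := by
    intro χ
    rw [Finset.sum_pow', ← Finset.sum_fiberwise_of_maps_to hmaps]
    refine Finset.sum_congr rfl fun m _ => ?_
    rw [Finset.sum_mul]
    refine Finset.sum_congr rfl fun f hf => ?_
    rw [Finset.prod_mul_distrib, ← (Finset.mem_filter.1 hf).2, Nat.cast_prod, map_prod]
  have hC : ∀ m, ‖C m‖ ≤ A ^ l * (F m).card := by
    intro m
    refine (norm_sum_le _ _).trans ?_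
    rw [mul_comm, ← nsmul_eq_mul]
    refine Finset.sum_le_card_nsmul _ _ _ fun f hf => ?_
    rw [norm_prod]
    calc ∏ i, ‖c (f i)‖ ≤ ∏ i : Fin l, A := Finset.prod_le_prod (fun _ _ => norm_nonneg _)
          (fun i _ => hc _ (hP f (Finset.mem_filter.1 hf).1 i))
      _ = A ^ l := by simp
  have hF : ∀ m, ((F m).card : ℝ) ≤ ρ := by
    intro m
    rcases (F m).eq_empty_or_nonempty with h | ⟨f, hf⟩
    · simp [h, hρ]
    · obtain ⟨hf1, rfl⟩ := Finset.mem_filter.1 hf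
      refine le_trans ?_ (hr f (hP f hf1))
      refine Nat.cast_le.2 (Finset.card_le_card fun g hg => ?_)
      rw [Nat.mem_finMulAntidiag]
      exact ⟨(Finset.mem_filter.1 hg).2,
        Finset.prod_ne_zero_iff.2 fun i _ => (hS _ (hP f hf1 i)).1⟩
  have hcard : ∑ m ∈ Finset.range (N ^ l), ((F m).card : ℝ) = S.card ^ l := by
    have := Finset.card_eq_sum_card_fiberwise hmaps
    rw [Fintype.card_piFinset_const] at this
    exact_mod_cast this.symm
  calc ∑ χ : DirichletCharacter ℂ q, ‖∑ b ∈ S, c b * χ b‖ ^ (2 * l)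
      = ∑ χ : DirichletCharacter ℂ q, ‖∑ m ∈ Finset.range (N ^ l), C m * χ m‖ ^ 2 := by
        refine Finset.sum_congr rfl fun χ _ => ?_
        rw [← hpow, norm_pow, ← pow_mul, mul_comm 2]
    _ ≤ _ := sum_norm_sq_le _ _
    _ ≤ _ := by
        gcongr
        calc ∑ m ∈ Finset.range (N ^ l), ‖C m‖ ^ 2
            ≤ ∑ m ∈ Finset.range (N ^ l), A ^ (2 * l) * ρ * (F m).card := by
              refine Finset.sum_le_sum fun m _ => ?_
              calc ‖C m‖ ^ 2 ≤ (A ^ l * (F m).card) ^ 2 := by gcongr; exact hC m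
                _ = A ^ (2 * l) * ((F m).card * (F m).card) := by ring
                _ ≤ A ^ (2 * l) * (ρ * (F m).card) := by gcongr; exact hF m
                _ = _ := by ring
          _ = _ := by rw [← Finset.mul_sum, hcard]

/-! ### Moments of twisted dyadic blocks -/

/-- The additive character `x ↦ exp (2πix)` of `ℝ`. -/
noncomputable def expi (x : ℝ) : ℂ := Complex.exp ((2 * Real.pi * x : ℝ) * Complex.I)

lemma norm_expi (x : ℝ) : ‖expi x‖ = 1 := Complex.norm_exp_ofReal_mul_I _

lemma expi_add (x y : ℝ) : expi (x + y) = expi x * expi y := by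
  rw [expi, expi, expi, ← Complex.exp_add]
  congr 1
  push_cast
  ring

lemma expi_intCast (n : ℤ) : expi n = 1 := by
  rw [expi, ← Complex.exp_int_mul_two_pi_mul_I n]
  congr 1
  push_cast
  ring

lemma expi_zero : expi 0 = 1 := by simpa using expi_intCast 0

lemma norm_expi_sub_le (x y : ℝ) : ‖expi x - expi y‖ ≤ 2 * Real.pi * |x - y| := by
  have h : expi x - expi y = expi y * (expi (x - y) - 1) := by
    rw [mul_sub, mul_one, ← expi_add, add_sub_cancel]
  rw [h, norm_mul, norm_expi, one_mul, expi, mul_comm _ Complex.I]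
  refine (Real.norm_exp_I_mul_ofReal_sub_one_le).trans (le_of_eq ?_)
  rw [Real.norm_eq_abs, abs_mul, abs_of_nonneg (by positivity)]

/-- `S` is a set of integers in `[4 ^ j, 4 ^ (j + 1))` without prime factors below `K ^ 32`. -/
def IsRoughBlock (K j : ℕ) (S : Finset ℕ) : Prop :=
  ∀ b ∈ S, 4 ^ j ≤ b ∧ b < 4 ^ (j + 1) ∧ ∀ p, p.Prime → p ∣ b → K ^ 32 ≤ p

namespace IsRoughBlock

variable {K j : ℕ} {S : Finset ℕ}

lemma card_le (h : IsRoughBlock K j S) : (S.card : ℝ) ≤ 4 * 4 ^ j := by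
  have : S.card ≤ 4 ^ (j + 1) := by
    rw [← Finset.card_range (4 ^ (j + 1))]
    exact Finset.card_le_card fun b hb => Finset.mem_range.2 (h b hb).2.1
  calc (S.card : ℝ) ≤ ((4 ^ (j + 1) : ℕ) : ℝ) := Nat.cast_le.2 this
    _ = 4 * 4 ^ j := by push_cast; ring

lemma norm_le (h : IsRoughBlock K j S) {c : ℕ → ℂ} (hc : ∀ b ∈ S, ‖c b‖ ≤ 1 / b) :
    ∀ b ∈ S, ‖c b‖ ≤ 1 / 4 ^ j := by
  intro b hb
  refine (hc b hb).trans ?_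
  have : (4 : ℝ) ^ j ≤ b := by exact_mod_cast (h b hb).1
  gcongr

/-- With `x = 2 ^ (1 / 16)`, the quantity `x ^ ((j + 1) * l)` is the 32nd root of `4 ^ ((j + 1) *
l)`, so roughness makes it an admissible bound for the number of factorizations. -/
lemma sum_norm_pow_le {q : ℕ} [NeZero q] (h : IsRoughBlock K j S) {c : ℕ → ℂ}
    (hc : ∀ b ∈ S, ‖c b‖ ≤ 1 / b) {l : ℕ} (hl : l ≠ 0) (hlK : l ≤ K) {x : ℝ} (hx0 : 0 ≤ x)
    (hx : x ^ 16 = 2) :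
    ∑ χ : DirichletCharacter ℂ q, ‖∑ b ∈ S, c b * χ b‖ ^ (2 * l) ≤
      q.totient * ((4 ^ ((j + 1) * l) / q + 1) * ((4 / 4 ^ j) ^ l * x ^ ((j + 1) * l))) := by
  have hpos : 0 < 4 ^ j := by positivity
  refine (CharacterSums.sum_norm_pow_le (q := q) S c l (4 ^ (j + 1)) (by positivity) hl
    (A := 1 / 4 ^ j) (ρ := x ^ ((j + 1) * l)) (fun b hb => ?_) (by positivity)
    (h.norm_le hc) (by positivity) (fun f hf => ?_)).trans ?_
  · have := h b hb
    exact ⟨by omega, this.2.1⟩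
  · have h0 : ∏ i, f i ≠ 0 := Finset.prod_ne_zero_iff.2 fun i _ => by
      have := h _ (hf i)
      omega
    have h1 := card_finMulAntidiag_pow_le hlK h0 fun p hp hdvd => by
      obtain ⟨i, -, hi⟩ := (Nat.Prime.prime hp).exists_mem_finset_dvd hdvd
      exact (h _ (hf i)).2.2 p hp hi
    have h2 : ∏ i, f i ≤ 4 ^ ((j + 1) * l) := by
      calc ∏ i, f i ≤ ∏ i : Fin l, 4 ^ (j + 1) :=
            Finset.prod_le_prod' fun i _ => (h _ (hf i)).2.1.le
        _ = 4 ^ ((j + 1) * l) := by simp [pow_mul]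
    refine le_of_pow_le_pow_left₀ (n := 32) (by norm_num) (by positivity) ?_
    calc ((Nat.finMulAntidiag l (∏ i, f i)).card : ℝ) ^ 32 ≤ 4 ^ ((j + 1) * l) := by
          exact_mod_cast h1.trans h2
      _ = (x ^ ((j + 1) * l)) ^ 32 := by
          rw [← pow_mul x, mul_comm _ 32, pow_mul x, show x ^ 32 = (x ^ 16) ^ 2 by ring, hx]
          norm_num
  · have e : ((((4 ^ (j + 1)) ^ l : ℕ) : ℝ)) = 4 ^ ((j + 1) * l) := by push_cast; rw [pow_mul]
    rw [e]
    refine mul_le_mul_of_nonneg_left (mul_le_mul_of_nonneg_left ?_ (by positivity)) (by positivity)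
    calc (1 / 4 ^ j : ℝ) ^ (2 * l) * x ^ ((j + 1) * l) * (S.card : ℝ) ^ l
        ≤ (1 / 4 ^ j) ^ (2 * l) * x ^ ((j + 1) * l) * (4 * 4 ^ j) ^ l := by
          gcongr
          exact h.card_le
      _ = (4 / 4 ^ j) ^ l * x ^ ((j + 1) * l) := by
          rw [pow_mul, mul_right_comm, ← mul_pow]
          congr 2
          field_simp

lemma norm_sum_le {q : ℕ} [NeZero q] (h : IsRoughBlock K j S) {c : ℕ → ℂ}
    (hc : ∀ b ∈ S, ‖c b‖ ≤ 1 / b) (χ : DirichletCharacter ℂ q) : ‖∑ b ∈ S, c b * χ b‖ ≤ 4 := by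
  calc ‖∑ b ∈ S, c b * χ b‖ ≤ S.card • (1 / 4 ^ j : ℝ) := by
        refine (norm_sum_le_of_le S fun b hb => ?_).trans_eq (Finset.sum_const (1 / 4 ^ j : ℝ))
        rw [norm_mul]
        calc ‖c b‖ * ‖χ b‖ ≤ 1 / 4 ^ j * 1 :=
              mul_le_mul (h.norm_le hc b hb) (χ.norm_le_one _) (norm_nonneg _) (by positivity)
          _ = 1 / 4 ^ j := mul_one _
    _ ≤ 4 := by
        rw [nsmul_eq_mul, mul_one_div, div_le_iff₀ (by positivity)]
        exact h.card_le

/-- The factor `8 ^ j` pays for a later union over grid points. Short blocks, whose `K`-th power has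
length at most `q`, give the geometric term; the remaining blocks save a power of `q`, which goes
into `δ`. -/
lemma grid_mul_sum_norm_pow_le {q : ℕ} [NeZero q] (h : IsRoughBlock K j S) {c : ℕ → ℂ}
    (hc : ∀ b ∈ S, ‖c b‖ ≤ 1 / b) (hK : 4 ≤ K) (hq : 256 < q) (hj : 16 ^ j ≤ 16 * q) {δ : ℝ}
    (hδ0 : 0 ≤ δ) (hδ : 16 * 16 ^ K * (q : ℝ) ^ (-(3 / 16) : ℝ) ≤ δ ^ (2 * K)) :
    8 ^ j * ∑ χ : DirichletCharacter ℂ q, ‖∑ b ∈ S, c b * χ b‖ ^ (2 * K) ≤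
      q.totient * (4 * (3 / 4) ^ j + δ) ^ (2 * K) := by
  have hq0 : (0 : ℝ) < q := by exact_mod_cast NeZero.pos q
  obtain ⟨x, hx0, hx⟩ : ∃ x : ℝ, 0 ≤ x ∧ x ^ 16 = 2 :=
    ⟨(2 : ℝ) ^ ((16 : ℕ) : ℝ)⁻¹, by positivity, Real.rpow_inv_natCast_pow (by norm_num) (by norm_num)⟩
  have hx2 : x ≤ 9 / 8 := by
    refine le_of_pow_le_pow_left₀ (n := 16) (by norm_num) (by norm_num) ?_
    rw [hx]; norm_num
  by_cases hcase : 4 ^ ((j + 1) * K) ≤ q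
  · have h1 := h.sum_norm_pow_le (q := q) hc (by omega) le_rfl hx0 hx
    have h2 : (4 : ℝ) ^ ((j + 1) * K) / q + 1 ≤ 2 := by
      have : (4 : ℝ) ^ ((j + 1) * K) / q ≤ 1 := by
        rw [div_le_one hq0]
        exact_mod_cast hcase
      linarith
    -- Since `K ≥ 4`, the grid factor costs only `2 ^ j` per `K`-th root, against a saving of `4 ^
    -- j`.
    have h3 : (8 : ℝ) ^ j ≤ (2 ^ j) ^ K := by
      rw [← pow_mul, show (8 : ℝ) = 2 ^ 3 by norm_num, ← pow_mul]
      refine pow_le_pow_right₀ (by norm_num) ?_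
      nlinarith
    have h4 : (2 : ℝ) ≤ 2 ^ K := by
      calc (2 : ℝ) = 2 ^ 1 := by norm_num
        _ ≤ 2 ^ K := pow_le_pow_right₀ (by norm_num) (by omega)
    calc 8 ^ j * ∑ χ : DirichletCharacter ℂ q, ‖∑ b ∈ S, c b * χ b‖ ^ (2 * K)
        ≤ (2 ^ j) ^ K * (q.totient * (2 ^ K * ((4 / 4 ^ j) ^ K * x ^ ((j + 1) * K)))) := by
          refine mul_le_mul h3 (h1.trans ?_) (Finset.sum_nonneg fun _ _ => by positivity)
            (by positivity)
          gcongr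
          exact h2.trans h4
      _ = q.totient * (8 * x * (x / 2) ^ j) ^ K := by
          rw [pow_mul, mul_left_comm, ← mul_pow, ← mul_pow, ← mul_pow, pow_succ x, div_pow,
            show (4 : ℝ) ^ j = 2 ^ j * 2 ^ j by rw [← mul_pow]; norm_num]
          congr 2
          field_simp
          ring
      _ ≤ q.totient * (16 * (9 / 16) ^ j) ^ K := by
          have : x / 2 ≤ 9 / 16 := by linarith
          gcongr
          linarith
      _ = q.totient * (4 * (3 / 4) ^ j) ^ (2 * K) := by
          rw [pow_mul, mul_pow 4, ← pow_mul (3 / 4 : ℝ), mul_comm j, pow_mul (3 / 4 : ℝ)]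
          norm_num
      _ ≤ _ := by
          gcongr
          linarith
  · push Not at hcase
    have hex : ∃ l, q ≤ 4 ^ ((j + 1) * l) := ⟨K, hcase.le⟩
    classical
    -- Use the least `l` for which the `l`-th power has length at least `q`, and bound the other `2
    -- * (K - l)` factors trivially by 4.
    obtain ⟨l, hl1, hl2, hlK⟩ : ∃ l, q ≤ 4 ^ ((j + 1) * l) ∧
        (∀ m < l, 4 ^ ((j + 1) * m) < q) ∧ l ≤ K :=
      ⟨Nat.find hex, Nat.find_spec hex, fun m hm => not_le.1 (Nat.find_min hex hm),
        Nat.find_min' hex hcase.le⟩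
    -- Here `q > 256` and `16 ^ j ≤ 16 * q` give `4 ^ (j + 1) < q`. With `l ≥ 2`, minimality of `l`
    -- yields `2 ^ ((j + 1) * l) < q`, so the factorization count costs at most `q ^ (1 / 16)`.
    have hl : 2 ≤ l := by
      by_contra hlt
      have h1 : q ≤ 4 ^ (j + 1) := hl1.trans
        (Nat.pow_le_pow_right (by norm_num) (by nlinarith))
      have h2 : 4 ^ (j + 1) * 4 ^ (j + 1) = 16 * 16 ^ j := by
        rw [← mul_pow, ← pow_succ']
        norm_num
      nlinarith
    have hQ : (1 : ℝ) ≤ 4 ^ ((j + 1) * l) / q := by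
      rw [one_le_div hq0]
      exact_mod_cast hl1
    have h1 := h.sum_norm_pow_le (q := q) hc (by omega) hlK hx0 hx
    have h2 : ∀ χ : DirichletCharacter ℂ q, ‖∑ b ∈ S, c b * χ b‖ ^ (2 * K) ≤
        16 ^ (K - l) * ‖∑ b ∈ S, c b * χ b‖ ^ (2 * l) := by
      intro χ
      rw [show 2 * K = 2 * (K - l) + 2 * l by omega, pow_add, pow_mul _ 2 (K - l)]
      gcongr
      nlinarith [h.norm_sum_le hc χ, norm_nonneg (∑ b ∈ S, c b * χ b)]
    -- The restriction to blocks up to about `√q` enters here: the grid costs `q ^ (3 / 4)`, and `3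
    -- / 4 + 1 / 16 - 1 = -3 / 16`.
    have h3 : (8 : ℝ) ^ j ≤ 8 * (q : ℝ) ^ (3 / 4 : ℝ) := by
      refine le_of_pow_le_pow_left₀ (n := 4) (by norm_num) (by positivity) ?_
      rw [mul_pow, ← Real.rpow_mul_natCast hq0.le]
      have h5 : ((16 : ℝ) ^ j) ^ 3 ≤ (16 * q) ^ 3 := by
        gcongr
        exact_mod_cast hj
      have h6 : (q : ℝ) ^ (3 / 4 * ((4 : ℕ) : ℝ) : ℝ) = q ^ 3 := by
        rw [← Real.rpow_natCast]; norm_num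
      rw [h6]
      calc ((8 : ℝ) ^ j) ^ (4 : ℕ) = ((16 : ℝ) ^ j) ^ 3 := by
            rw [← pow_mul, ← pow_mul, mul_comm j, mul_comm j, pow_mul, pow_mul]
            norm_num
        _ ≤ (16 * (q : ℝ)) ^ 3 := h5
        _ = 8 ^ 4 * (q : ℝ) ^ 3 := by ring
    have h4 : x ^ ((j + 1) * l) ≤ (q : ℝ) ^ (1 / 16 : ℝ) := by
      refine le_of_pow_le_pow_left₀ (n := 16) (by norm_num) (by positivity) ?_
      rw [← Real.rpow_mul_natCast hq0.le, ← pow_mul, mul_comm _ 16, pow_mul, hx]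
      norm_num
      have h5 := hl2 (l - 1) (by omega)
      have h6 : 2 ^ ((j + 1) * l) ≤ 4 ^ ((j + 1) * (l - 1)) := by
        rw [show 4 = 2 ^ 2 by norm_num, ← pow_mul]
        refine Nat.pow_le_pow_right (by norm_num) ?_
        rw [mul_left_comm]
        exact Nat.mul_le_mul_left _ (by omega)
      exact_mod_cast h6.trans h5.le
    calc 8 ^ j * ∑ χ : DirichletCharacter ℂ q, ‖∑ b ∈ S, c b * χ b‖ ^ (2 * K)
        ≤ 8 ^ j * (16 ^ (K - l) * ∑ χ : DirichletCharacter ℂ q,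
            ‖∑ b ∈ S, c b * χ b‖ ^ (2 * l)) := by
          rw [Finset.mul_sum _ _ ((16 : ℝ) ^ _)]
          gcongr with χ
          exact h2 χ
      _ ≤ (8 * (q : ℝ) ^ (3 / 4 : ℝ)) * (16 ^ (K - l) * (q.totient *
            ((4 ^ ((j + 1) * l) / q + 4 ^ ((j + 1) * l) / q) *
              ((4 / 4 ^ j) ^ l * (q : ℝ) ^ (1 / 16 : ℝ))))) := by
          gcongr
          refine h1.trans ?_
          gcongr
      _ = q.totient * (16 * (16 ^ (K - l) * (4 ^ (j + 1) * (4 / 4 ^ j)) ^ l) *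
            ((q : ℝ) ^ (3 / 4 : ℝ) * (q : ℝ) ^ (1 / 16 : ℝ) * (q : ℝ) ^ (-1 : ℝ))) := by
          rw [mul_pow _ _ l, ← pow_mul, Real.rpow_neg_one]
          ring
      _ = q.totient * (16 * 16 ^ K * (q : ℝ) ^ (-(3 / 16) : ℝ)) := by
          rw [← Real.rpow_add hq0, ← Real.rpow_add hq0,
            show (4 : ℝ) ^ (j + 1) * (4 / 4 ^ j) = 16 by rw [pow_succ]; field_simp; norm_num,
            ← pow_add, Nat.sub_add_cancel hlK]
          norm_num
      _ ≤ q.totient * δ ^ (2 * K) := by gcongr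
      _ ≤ _ := by
          gcongr
          have : (0 : ℝ) ≤ 4 * (3 / 4) ^ j := by positivity
          linarith

/-- The moment bound for a block, uniform over twists `expi (b * θ χ)` depending on `χ`. -/
lemma sum_norm_twist_pow_le {q : ℕ} [NeZero q] (h : IsRoughBlock K j S) {c : ℕ → ℂ}
    (hc : ∀ b ∈ S, ‖c b‖ ≤ 1 / b) (hK : 4 ≤ K) (hq : 256 < q) (hj : 16 ^ j ≤ 16 * q) {δ : ℝ}
    (hδ0 : 0 ≤ δ) (hδ : 16 * 16 ^ K * (q : ℝ) ^ (-(3 / 16) : ℝ) ≤ δ ^ (2 * K))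
    (θ : DirichletCharacter ℂ q → ℝ) :
    ∑ χ : DirichletCharacter ℂ q, ‖∑ b ∈ S, c b * expi (b * θ χ) * χ b‖ ^ (2 * K) ≤
      q.totient * (8 * Real.pi * (1 / 2) ^ j + (4 * (3 / 4) ^ j + δ)) ^ (2 * K) := by
  -- Only `θ χ` modulo 1 matters, as `b` is an integer. Rounding it down to spacing `8 ^ (-j)`
  -- changes the block by `O(2 ^ (-j))`.
  let r : DirichletCharacter ℂ q → ℕ := fun χ => ⌊8 ^ j * Int.fract (θ χ)⌋₊
  let G : DirichletCharacter ℂ q → ℕ → ℝ := fun χ m =>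
    ‖∑ b ∈ S, c b * expi (b * (m / 8 ^ j)) * χ b‖
  have h8 : (0 : ℝ) < 8 ^ j := by positivity
  have hr : ∀ χ, r χ ∈ Finset.range (8 ^ j) := by
    intro χ
    rw [Finset.mem_range, Nat.floor_lt (mul_nonneg h8.le (Int.fract_nonneg _))]
    push_cast
    nlinarith [Int.fract_lt_one (θ χ)]
  have happrox : ∀ χ, |Int.fract (θ χ) - r χ / 8 ^ j| ≤ 1 / 8 ^ j := by
    intro χ
    have h1 := Nat.floor_le (mul_nonneg h8.le (Int.fract_nonneg (θ χ)))
    have h2 := Nat.lt_floor_add_one (8 ^ j * Int.fract (θ χ))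
    have e : Int.fract (θ χ) - r χ / 8 ^ j = (8 ^ j * Int.fract (θ χ) - r χ) / 8 ^ j := by
      field_simp
    rw [e, abs_div, abs_of_pos h8]
    gcongr
    rw [abs_le]
    constructor <;> linarith
  have hdiff : ∀ χ : DirichletCharacter ℂ q, ∀ b ∈ S,
      ‖expi (b * θ χ) - expi (b * (r χ / 8 ^ j))‖ ≤ 2 * Real.pi * (b / 8 ^ j) := by
    intro χ b _
    have e : expi (b * θ χ) = expi (b * Int.fract (θ χ)) := by
      rw [← mul_one (expi (b * Int.fract (θ χ))), ← expi_intCast (b * ⌊θ χ⌋), ← expi_add]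
      congr 1
      have := Int.fract_add_floor (θ χ)
      push_cast
      rw [← mul_add, this]
    rw [e]
    refine (norm_expi_sub_le _ _).trans ?_
    rw [← mul_sub, abs_mul, Nat.abs_cast]
    have := happrox χ
    calc 2 * Real.pi * (b * |Int.fract (θ χ) - r χ / 8 ^ j|)
        ≤ 2 * Real.pi * (b * (1 / 8 ^ j)) := by gcongr
      _ = _ := by ring
  have hle : ∀ χ : DirichletCharacter ℂ q, ‖∑ b ∈ S, c b * expi (b * θ χ) * χ b‖ ≤
      8 * Real.pi * (1 / 2) ^ j + G χ (r χ) := by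
    intro χ
    have e : ∑ b ∈ S, c b * expi (b * θ χ) * χ b =
        ∑ b ∈ S, c b * (expi (b * θ χ) - expi (b * (r χ / 8 ^ j))) * χ b +
          ∑ b ∈ S, c b * expi (b * (r χ / 8 ^ j)) * χ b := by
      rw [← Finset.sum_add_distrib]
      exact Finset.sum_congr rfl fun b _ => by ring
    rw [e]
    refine (norm_add_le _ _).trans (add_le_add ?_ le_rfl)
    calc ‖∑ b ∈ S, c b * (expi (b * θ χ) - expi (b * (r χ / 8 ^ j))) * χ b‖
        ≤ ∑ b ∈ S, 2 * Real.pi / 8 ^ j := by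
          refine norm_sum_le_of_le S fun b hb => ?_
          have hb0 : (0 : ℝ) < b := by
            have := (h b hb).1
            have h4 : 0 < 4 ^ j := by positivity
            exact_mod_cast h4.trans_le this
          rw [norm_mul, norm_mul]
          calc ‖c b‖ * ‖expi (b * θ χ) - expi (b * (r χ / 8 ^ j))‖ * ‖χ b‖
              ≤ 1 / b * (2 * Real.pi * (b / 8 ^ j)) * 1 := by
                gcongr
                · exact hc b hb
                · exact hdiff χ b hb
                · exact χ.norm_le_one _
            _ = _ := by field_simp
      _ ≤ 4 * 4 ^ j * (2 * Real.pi / 8 ^ j) := by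
          rw [Finset.sum_const, nsmul_eq_mul]
          gcongr
          exact h.card_le
      _ = 8 * Real.pi * (1 / 2) ^ j := by
          rw [show (8 : ℝ) ^ j = 4 ^ j * 2 ^ j by rw [← mul_pow]; norm_num, one_div, inv_pow]
          field_simp
          norm_num
  refine (Finset.sum_le_sum fun χ _ => pow_le_pow_left₀ (norm_nonneg _) (hle χ) _).trans ?_
  refine sum_add_pow_le _ (by omega) (Nat.cast_nonneg _) (by positivity) (by positivity)
    (fun χ _ => by positivity) (fun χ _ => norm_nonneg _) ?_ ?_
  · rw [Finset.sum_const, Finset.card_univ, nsmul_eq_mul, ← Nat.card_eq_fintype_card,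
      DirichletCharacter.card_eq_totient_of_hasEnoughRootsOfUnity]
  -- Replacing the term at `r χ` by the sum over all grid points decouples the twist from `χ`.
  · calc ∑ χ : DirichletCharacter ℂ q, G χ (r χ) ^ (2 * K)
        ≤ ∑ χ : DirichletCharacter ℂ q, ∑ m ∈ Finset.range (8 ^ j), G χ m ^ (2 * K) :=
          Finset.sum_le_sum fun χ _ => Finset.single_le_sum
            (f := fun m => G χ m ^ (2 * K)) (fun m _ => by positivity) (hr χ)
      _ = ∑ m ∈ Finset.range (8 ^ j), ∑ χ : DirichletCharacter ℂ q, G χ m ^ (2 * K) :=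
          Finset.sum_comm
      _ ≤ ∑ m ∈ Finset.range (8 ^ j),
            (q.totient * (4 * (3 / 4) ^ j + δ) ^ (2 * K)) / 8 ^ j := by
          refine Finset.sum_le_sum fun m _ => ?_
          rw [le_div_iff₀' h8]
          refine h.grid_mul_sum_norm_pow_le (c := fun b => c b * expi (b * (m / 8 ^ j)))
            (fun b hb => ?_) hK hq hj hδ0 hδ
          rw [norm_mul, norm_expi, mul_one]
          exact hc b hb
      _ = _ := by
          rw [Finset.sum_const, Finset.card_range, nsmul_eq_mul]
          push_cast
          field_simp

end IsRoughBlock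

/-! ### Moments of exponential sums with logarithmic weights -/

lemma exists_smooth_mul_rough (y : ℕ) {m : ℕ} (hm : m ≠ 0) : ∃ a b : ℕ, m = a * b ∧
    a ∈ Nat.smoothNumbers y ∧ ∀ p, p.Prime → p ∣ b → y ≤ p := by
  induction m using induction_on_primes with
  | zero => exact absurd rfl hm
  | one =>
    refine ⟨1, 1, rfl, ?_, fun p hp h => absurd h hp.not_dvd_one⟩
    simp [Nat.mem_smoothNumbers]
  | prime_mul p n hp ih =>
    obtain ⟨a, b, rfl, ha, hb⟩ := ih (right_ne_zero_of_mul hm)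
    by_cases hpy : p < y
    · refine ⟨p * a, b, by ring, Nat.mul_mem_smoothNumbers ?_ ha, hb⟩
      rw [Nat.mem_smoothNumbers, Nat.primeFactorsList_prime hp]
      exact ⟨hp.ne_zero, by simpa using hpy⟩
    · refine ⟨a, p * b, by ring, ha, fun r hr hdvd => ?_⟩
      rcases (Nat.Prime.dvd_mul hr).1 hdvd with h | h
      · rw [(Nat.prime_dvd_prime_iff_eq hr hp).1 h]
        omega
      · exact hb r hr h

lemma tendsto_log_pow_mul_rpow_neg (n : ℕ) {c : ℝ} (hc : 0 < c) :
    Tendsto (fun q : ℕ => Real.log q ^ n * (q : ℝ) ^ (-c)) atTop (nhds 0) := by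
  have h := (isLittleO_log_rpow_rpow_atTop (n : ℝ) hc).tendsto_div_nhds_zero
  refine (h.comp tendsto_natCast_atTop_atTop).congr fun q => ?_
  simp only [Function.comp, Real.rpow_natCast]
  rw [Real.rpow_neg (Nat.cast_nonneg q), div_eq_mul_inv]

lemma sum_range_geometric_le {x : ℝ} (hx0 : 0 ≤ x) (hx1 : x < 1) (J : ℕ) :
    ∑ j ∈ Finset.range J, x ^ j ≤ (1 - x)⁻¹ := by
  rw [← tsum_geometric_of_lt_one hx0 hx1]
  exact (summable_geometric_of_lt_one hx0 hx1).sum_le_tsum _ fun _ _ => by positivity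

/-- Splitting `m = a * b` into its `K ^ 32`-smooth and `K ^ 32`-rough parts. -/
lemma sum_norm_logWeight_pow_le {q K Y : ℕ} [NeZero q] (hK : 4 ≤ K) (hq : 256 < q)
    (hY : Y ^ 2 ≤ 16 * q) {δ : ℝ} (hδ0 : 0 ≤ δ)
    (hδ : 16 * 16 ^ K * (q : ℝ) ^ (-(3 / 16) : ℝ) ≤ δ ^ (2 * K))
    (hJ : (Nat.log 4 Y + 1 : ℕ) * δ ≤ 1) {B : ℝ} (hB0 : 0 ≤ B)
    (hB : ∀ s : Finset ℕ, (∀ a ∈ s, a ∈ Nat.smoothNumbers (K ^ 32)) → ∑ a ∈ s, 1 / (a : ℝ) ≤ B)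
    {w : ℕ → ℂ} (hw : ∀ m, m ≠ 0 → ‖w m‖ ≤ 1 / m) (θ : DirichletCharacter ℂ q → ℝ) :
    ∑ χ : DirichletCharacter ℂ q,
      ‖∑ m ∈ Finset.Icc 1 Y, w m * expi (m * θ χ) * χ m‖ ^ (2 * K) ≤
      q.totient * (B * (16 * Real.pi + 17)) ^ (2 * K) := by
  classical
  have hex : ∀ m : ℕ, ∃ a b : ℕ, m ≠ 0 → m = a * b ∧
      a ∈ Nat.smoothNumbers (K ^ 32) ∧ ∀ p, p.Prime → p ∣ b → K ^ 32 ≤ p := by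
    intro m
    by_cases hm : m = 0
    · exact ⟨0, 0, fun h => absurd hm h⟩
    · obtain ⟨a, b, h⟩ := exists_smooth_mul_rough (K ^ 32) hm
      exact ⟨a, b, fun _ => h⟩
  choose α β hαβ using hex
  let T := Finset.Icc 1 Y
  have hT : ∀ m ∈ T, m ≠ 0 := fun m hm => by have := (Finset.mem_Icc.1 hm).1; omega
  let A := T.image α
  let J := Nat.log 4 Y + 1
  let F : ℕ → ℕ → Finset ℕ := fun a j => T.filter fun m => α m = a ∧ Nat.log 4 (β m) = j
  let S : ℕ → ℕ → Finset ℕ := fun a j => (F a j).image β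
  have hA : ∀ a ∈ A, a ∈ Nat.smoothNumbers (K ^ 32) := by
    intro a ha
    obtain ⟨m, hm, rfl⟩ := Finset.mem_image.1 ha
    exact (hαβ m (hT m hm)).2.1
  have hβ0 : ∀ m ∈ T, β m ≠ 0 := fun m hm h0 => by
    have := (hαβ m (hT m hm)).1
    rw [h0, mul_zero] at this
    exact hT m hm this
  have hS : ∀ a j, IsRoughBlock K j (S a j) := by
    intro a j b hb
    obtain ⟨m, hm, rfl⟩ := Finset.mem_image.1 hb
    obtain ⟨hmT, -, rfl⟩ := Finset.mem_filter.1 hm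
    exact ⟨Nat.pow_log_le_self 4 (hβ0 m hmT), Nat.lt_pow_succ_log_self (by norm_num) _,
      (hαβ m (hT m hmT)).2.2⟩
  have hinj : ∀ a j, Set.InjOn β (F a j) := by
    intro a j m hm n hn hmn
    obtain ⟨hmT, hma, -⟩ := Finset.mem_filter.1 hm
    obtain ⟨hnT, hna, -⟩ := Finset.mem_filter.1 hn
    rw [(hαβ m (hT m hmT)).1, (hαβ n (hT n hnT)).1, hma, hna, hmn]
  let f : ℕ × ℕ → DirichletCharacter ℂ q → ℝ := fun x χ =>
    ‖∑ b ∈ S x.1 x.2, w (x.1 * b) * expi (b * (x.1 * θ χ)) * χ b‖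
  have hle : ∀ χ : DirichletCharacter ℂ q,
      ‖∑ m ∈ T, w m * expi (m * θ χ) * χ m‖ ≤ ∑ x ∈ A ×ˢ Finset.range J, f x χ := by
    intro χ
    have hmaps : ∀ m ∈ T, (α m, Nat.log 4 (β m)) ∈ A ×ˢ Finset.range J := by
      intro m hm
      refine Finset.mem_product.2 ⟨Finset.mem_image_of_mem _ hm, Finset.mem_range.2 ?_⟩
      refine Nat.lt_succ_of_le (show Nat.log 4 (β m) ≤ Nat.log 4 Y from Nat.log_mono_right ?_)
      have h1 := (hαβ m (hT m hm)).1
      have h2 : α m ≠ 0 := fun h0 => hT m hm (by rw [h1, h0, zero_mul])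
      calc β m ≤ α m * β m := Nat.le_mul_of_pos_left _ (Nat.pos_of_ne_zero h2)
        _ = m := h1.symm
        _ ≤ Y := (Finset.mem_Icc.1 hm).2
    rw [← Finset.sum_fiberwise_of_maps_to hmaps]
    refine norm_sum_le_of_le _ fun x _ => ?_
    have hfil : T.filter (fun m => (α m, Nat.log 4 (β m)) = x) = F x.1 x.2 :=
      Finset.filter_congr fun m _ => Prod.ext_iff
    rw [hfil]
    -- On a fibre with fixed smooth part `a`, `χ a` factors out and the twist becomes `a * θ χ`,
    -- still arbitrary in `χ`.
    have e : ∑ m ∈ F x.1 x.2, w m * expi (m * θ χ) * χ m =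
        χ (x.1 : ℕ) * ∑ b ∈ S x.1 x.2, w (x.1 * b) * expi (b * (x.1 * θ χ)) * χ b := by
      rw [Finset.sum_image (hinj x.1 x.2), Finset.mul_sum]
      refine Finset.sum_congr rfl fun m hm => ?_
      obtain ⟨hmT, hma, -⟩ := Finset.mem_filter.1 hm
      have h1 := (hαβ m (hT m hmT)).1
      rw [hma] at h1
      have h2 : (m : ℝ) = β m * x.1 := by
        rw [mul_comm]
        exact_mod_cast h1
      have h3 : (m : ZMod q) = (x.1 : ℕ) * (β m : ℕ) := by exact_mod_cast congrArg (Nat.cast) h1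
      rw [h3, map_mul, ← h1, h2]
      ring_nf
    rw [e, norm_mul]
    exact mul_le_of_le_one_left (norm_nonneg _) (χ.norm_le_one _)
  refine (Finset.sum_le_sum fun χ _ => pow_le_pow_left₀ (norm_nonneg _) (hle χ) _).trans ?_
  let u : ℕ × ℕ → ℝ := fun x =>
    1 / (x.1 : ℝ) * (8 * Real.pi * (1 / 2) ^ x.2 + (4 * (3 / 4) ^ x.2 + δ))
  refine (sum_sum_pow_le Finset.univ (A ×ˢ Finset.range J) (f := f) (u := u) (by omega)
    (Nat.cast_nonneg q.totient) (fun x _ => by positivity) (fun x _ χ _ => norm_nonneg _)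
    fun x hx => ?_).trans ?_
  · obtain ⟨hxA, hxJ⟩ := Finset.mem_product.1 hx
    have ha0 : x.1 ≠ 0 := Nat.ne_zero_of_mem_smoothNumbers (hA _ hxA)
    have ha : (0 : ℝ) < x.1 := by exact_mod_cast Nat.pos_of_ne_zero ha0
    have hj : 16 ^ x.2 ≤ 16 * q := by
      rcases Nat.eq_zero_or_pos Y with rfl | hYpos
      · simp only [Finset.mem_range, J, Nat.log_zero_right, zero_add, Nat.lt_one_iff] at hxJ
        rw [hxJ]
        omega
      · have h1 : 4 ^ x.2 ≤ Y :=
          (Nat.pow_le_pow_right (by norm_num) (Nat.lt_succ_iff.1 (Finset.mem_range.1 hxJ))).trans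
            (Nat.pow_log_le_self 4 hYpos.ne')
        calc 16 ^ x.2 = (4 ^ x.2) ^ 2 := by rw [← pow_mul, mul_comm, pow_mul]; norm_num
          _ ≤ Y ^ 2 := Nat.pow_le_pow_left h1 2
          _ ≤ 16 * q := hY
    have hmain := (hS x.1 x.2).sum_norm_twist_pow_le (q := q) (c := fun b => x.1 * w (x.1 * b))
      (fun b hb => by
        have hb0 : b ≠ 0 := by
          have h4 : 0 < 4 ^ x.2 := by positivity
          have := (hS x.1 x.2 b hb).1
          omega
        have hb : (0 : ℝ) < b := by exact_mod_cast Nat.pos_of_ne_zero hb0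
        have := hw (x.1 * b) (mul_ne_zero ha0 hb0)
        rw [norm_mul, Complex.norm_natCast]
        push_cast at this
        calc (x.1 : ℝ) * ‖w (x.1 * b)‖ ≤ x.1 * (1 / (x.1 * b)) := by gcongr
          _ = 1 / b := by field_simp) hK hq hj hδ0 hδ (fun χ => x.1 * θ χ)
    have e : ∀ χ : DirichletCharacter ℂ q, f x χ = 1 / (x.1 : ℝ) *
        ‖∑ b ∈ S x.1 x.2, x.1 * w (x.1 * b) * expi (b * (x.1 * θ χ)) * χ b‖ := by
      intro χ
      have : ∑ b ∈ S x.1 x.2, x.1 * w (x.1 * b) * expi (b * (x.1 * θ χ)) * χ b =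
          x.1 * ∑ b ∈ S x.1 x.2, w (x.1 * b) * expi (b * (x.1 * θ χ)) * χ b := by
        rw [Finset.mul_sum]
        exact Finset.sum_congr rfl fun b _ => by ring
      rw [this, norm_mul, Complex.norm_natCast, ← mul_assoc, one_div_mul_cancel ha.ne', one_mul]
    simp only [e, u, mul_pow (1 / (x.1 : ℝ))]
    rw [← Finset.mul_sum, mul_left_comm]
    gcongr
  · gcongr
    rw [Finset.sum_product]
    simp only [u, ← Finset.mul_sum]
    rw [← Finset.sum_mul]
    have h1 := sum_range_geometric_le (x := 1 / 2) (by norm_num) (by norm_num) J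
    have h2 := sum_range_geometric_le (x := 3 / 4) (by norm_num) (by norm_num) J
    -- The two geometric series contribute `16π` and `16`, and the `J` copies of `δ` at most `1`.
    have h3 : ∑ j ∈ Finset.range J, (8 * Real.pi * (1 / 2) ^ j + (4 * (3 / 4) ^ j + δ)) ≤
        16 * Real.pi + 17 := by
      rw [Finset.sum_add_distrib, Finset.sum_add_distrib, ← Finset.mul_sum, ← Finset.mul_sum,
        Finset.sum_const, Finset.card_range, nsmul_eq_mul]
      norm_num at h1 h2
      norm_num
      have := Real.pi_pos
      have : (J : ℝ) * δ ≤ 1 := hJ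
      nlinarith
    exact mul_le_mul (hB A hA) h3 (Finset.sum_nonneg fun _ _ => by positivity) hB0

/-- The choice `δ = 1 / (2 log q)` is small enough to be summed over the `O(log q)` blocks, yet its
`2K`-th power exceeds any fixed negative power of `q` eventually. -/
lemma eventually_exists_error {K : ℕ} : ∀ᶠ q : ℕ in atTop,
    256 < q ∧ ∃ δ : ℝ, 0 ≤ δ ∧ 16 * 16 ^ K * (q : ℝ) ^ (-(3 / 16) : ℝ) ≤ δ ^ (2 * K) ∧
      ∀ Y : ℕ, Y ^ 2 ≤ 16 * q → (Nat.log 4 Y + 1 : ℕ) * δ ≤ 1 := by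
  have h := (tendsto_log_pow_mul_rpow_neg (2 * K) (c := 3 / 16) (by norm_num)).const_mul
    (16 * 16 ^ K * 2 ^ (2 * K))
  rw [mul_zero] at h
  filter_upwards [h.eventually_le_const zero_lt_one, eventually_gt_atTop 256] with q hq hq256
  have hq' : (256 : ℝ) < q := by exact_mod_cast hq256
  have hlog : 1 ≤ Real.log q := by
    rw [Real.le_log_iff_exp_le (by linarith)]
    linarith [Real.exp_one_lt_three]
  refine ⟨hq256, 1 / (2 * Real.log q), by positivity, ?_, fun Y hY => ?_⟩
  · rw [one_div, inv_pow, ← one_div, le_div_iff₀ (by positivity), mul_pow]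
    linarith
  · have hYq : Y ≤ q := by nlinarith
    have h1 : (Nat.log 4 Y : ℝ) ≤ Real.log q := by
      rcases Nat.eq_zero_or_pos Y with rfl | hY0
      · simp; linarith
      have h2 : ((4 ^ Nat.log 4 Y : ℕ) : ℝ) ≤ q :=
        Nat.cast_le.2 ((Nat.pow_log_le_self 4 hY0.ne').trans hYq)
      have h3 := Real.log_le_log (by positivity) h2
      push_cast at h3
      rw [Real.log_pow] at h3
      have h4 : 1 ≤ Real.log 4 := by
        rw [Real.le_log_iff_exp_le (by norm_num)]
        linarith [Real.exp_one_lt_three]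
      nlinarith [Nat.cast_nonneg (α := ℝ) (Nat.log 4 Y)]
    rw [mul_one_div, div_le_one (by positivity)]
    push_cast
    linarith

lemma exists_sum_norm_logWeight_pow_le : ∃ C : ℝ, 0 < C ∧ ∀ K : ℕ, 4 ≤ K → ∃ q₀ : ℕ,
    ∀ (q : ℕ) [NeZero q], q₀ ≤ q → ∀ Y : ℕ, Y ^ 2 ≤ 16 * q →
    ∀ w : ℕ → ℂ, (∀ m, m ≠ 0 → ‖w m‖ ≤ 1 / m) → ∀ θ : DirichletCharacter ℂ q → ℝ,
    ∑ χ : DirichletCharacter ℂ q,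
      ‖∑ m ∈ Finset.Icc 1 Y, w m * expi (m * θ χ) * χ m‖ ^ (2 * K) ≤
      q.totient * (C * Real.log K ^ 2) ^ (2 * K) := by
  obtain ⟨C, hC, hsm⟩ := exists_sum_inv_smoothNumbers_le
  refine ⟨C * 32 ^ 2 * (16 * Real.pi + 17), by positivity, fun K hK => ?_⟩
  obtain ⟨q₀, hq₀⟩ := eventually_atTop.1 (eventually_exists_error (K := K))
  refine ⟨q₀, fun q _ hq Y hY w hw θ => ?_⟩
  obtain ⟨hq256, δ, hδ0, hδ, hJ⟩ := hq₀ q hq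
  have h3 : 3 ≤ K ^ 32 := by
    calc 3 ≤ K ^ 1 := by rw [pow_one]; omega
      _ ≤ K ^ 32 := Nat.pow_le_pow_right (by omega) (by norm_num)
  refine (sum_norm_logWeight_pow_le hK hq256 hY hδ0 hδ (hJ Y hY)
    (B := C * Real.log (K ^ 32 : ℕ) ^ 2) (by positivity) (hsm _ h3) hw θ).trans_eq ?_
  push_cast
  rw [Real.log_pow]
  push_cast
  ring

/-! ### A truncated Fourier expansion for primitive characters -/

lemma expi_natCast_mul (n : ℕ) (x : ℝ) : expi (n * x) = expi x ^ n := by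
  rw [expi, expi, ← Complex.exp_nat_mul]
  congr 1
  push_cast
  ring

lemma four_mul_abs_le_norm_expi_sub_one {x : ℝ} (hx : |x| ≤ 1 / 2) : 4 * |x| ≤ ‖expi x - 1‖ := by
  rw [expi, mul_comm _ Complex.I, Complex.norm_exp_I_mul_ofReal_sub_one, norm_mul,
    Real.norm_ofNat, Real.norm_eq_abs, show 2 * Real.pi * x / 2 = Real.pi * x by ring]
  have key : ∀ y : ℝ, 0 ≤ y → y ≤ 1 / 2 → 2 * y ≤ Real.sin (Real.pi * y) := by
    intro y h0 h1
    have hpi := Real.pi_pos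
    have h := Real.mul_le_sin (x := Real.pi * y) (by positivity) (by nlinarith)
    refine le_trans (le_of_eq ?_) h
    field_simp
  have h : |Real.sin (Real.pi * x)| = |Real.sin (Real.pi * |x|)| := by
    rcases abs_cases x with ⟨h, -⟩ | ⟨h, -⟩ <;> rw [h]
    rw [mul_neg, Real.sin_neg, abs_neg]
  rw [h]
  have h1 := key |x| (abs_nonneg x) hx
  have h2 := le_abs_self (Real.sin (Real.pi * |x|))
  linarith

lemma stdAddChar_intCast {q : ℕ} [NeZero q] (m : ℤ) :
    ZMod.stdAddChar (m : ZMod q) = expi (m / q) := by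
  rw [ZMod.stdAddChar_coe, expi]
  congr 1
  push_cast
  ring

/-- Evaluate the double Fourier transform of `χ` at `-1`: inversion gives `q`, while the transform
formula for primitive characters gives `star g * g`. -/
lemma norm_gaussSum_of_isPrimitive {q : ℕ} [NeZero q] {χ : DirichletCharacter ℂ q}
    (hχ : χ.IsPrimitive) : ‖gaussSum χ ZMod.stdAddChar‖ = Real.sqrt q := by
  set g := gaussSum χ ZMod.stdAddChar with hg
  have h1 : ZMod.dft (ZMod.dft χ) (-1) = (q : ℂ) := by
    rw [ZMod.dft_dft]
    simp
  have h2 : ZMod.dft (ZMod.dft χ) (-1) = star g * g := by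
    rw [ZMod.dft_apply, hg, star_gaussSum_eq, gaussSum, Finset.sum_mul]
    refine Fintype.sum_equiv (Equiv.neg _) _ _ fun k => ?_
    rw [hχ.fourierTransform_eq_inv_mul_gaussSum, smul_eq_mul, AddChar.inv_apply]
    simp only [Equiv.neg_apply, mul_neg, mul_one, neg_neg]
    ring
  rw [h1] at h2
  have h3 : (q : ℝ) = ‖g‖ ^ 2 := by
    have := congrArg norm h2
    rw [norm_mul, norm_star, Complex.norm_natCast] at this
    rw [this, sq]
  rw [h3, Real.sqrt_sq (norm_nonneg _)]

lemma inv_apply_mul_gaussSum {q : ℕ} [NeZero q] {χ : DirichletCharacter ℂ q}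
    (hχ : χ.IsPrimitive) (n : ℕ) :
    χ⁻¹ (n : ZMod q) * gaussSum χ ZMod.stdAddChar =
      ∑ j : ZMod q, χ j * ZMod.stdAddChar j ^ n := by
  have h := hχ.fourierTransform_eq_inv_mul_gaussSum (-(n : ZMod q))
  rw [neg_neg] at h
  rw [← h, ZMod.dft_apply]
  refine Finset.sum_congr rfl fun j _ => ?_
  rw [mul_neg, neg_neg, smul_eq_mul, mul_comm, ← AddChar.map_nsmul_eq_pow, nsmul_eq_mul, mul_comm j]

/-- Symmetric representatives keep `|m / q| ≤ 1 / 2`, the range where `‖expi x - 1‖` is comparable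
to `|x|`. -/
lemma sum_zmod_eq {q : ℕ} [NeZero q] (F : ZMod q → ℂ) :
    ∑ j : ZMod q, F j = F 0 + ∑ m ∈ Finset.Icc 1 (q / 2), F (m : ℤ) +
      ∑ m ∈ Finset.Icc 1 ((q - 1) / 2), F (-(m : ℤ) : ℤ) := by
  have hq := NeZero.pos q
  have h1 : ∑ j : ZMod q, F j = ∑ n ∈ Finset.range q, F n := by
    symm
    refine Finset.sum_bij' (fun n _ => (n : ZMod q)) (fun a _ => a.val) ?_ ?_ ?_ ?_ ?_
    · simp
    · intro a _
      exact Finset.mem_range.2 a.val_lt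
    · intro n hn
      exact ZMod.val_cast_of_lt (Finset.mem_range.1 hn)
    · intro a _
      exact ZMod.natCast_zmod_val a
    · simp
  have h2 : Finset.range q = ({0} ∪ Finset.Icc 1 (q / 2)) ∪ Finset.Ioo (q / 2) q := by
    ext n
    simp only [Finset.mem_range, Finset.mem_union, Finset.mem_singleton, Finset.mem_Icc,
      Finset.mem_Ioo]
    omega
  rw [h1, h2, Finset.sum_union, Finset.sum_union, Finset.sum_singleton]
  · congr 1
    · simp
    · refine Finset.sum_bij' (fun n _ => q - n) (fun n _ => q - n) ?_ ?_ ?_ ?_ ?_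
      · intro n hn
        rw [Finset.mem_Ioo] at hn
        rw [Finset.mem_Icc]
        omega
      · intro n hn
        rw [Finset.mem_Icc] at hn
        rw [Finset.mem_Ioo]
        omega
      · intro n hn
        rw [Finset.mem_Ioo] at hn
        omega
      · intro n hn
        rw [Finset.mem_Icc] at hn
        omega
      · intro n hn
        rw [Finset.mem_Ioo] at hn
        congr 1
        push_cast [Nat.cast_sub hn.2.le]
        simp
  · rw [Finset.disjoint_left]
    intro n hn hn'
    rw [Finset.mem_singleton] at hn
    rw [Finset.mem_Icc] at hn'
    omega
  · rw [Finset.disjoint_left]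
    intro n hn hn'
    rw [Finset.mem_union, Finset.mem_singleton, Finset.mem_Icc] at hn
    rw [Finset.mem_Ioo] at hn'
    omega

/-- The Fourier weight of an interval averaged over `H` shifts. -/
noncomputable def shiftWeight (q H : ℕ) (x : ℝ) : ℂ :=
  expi x * (∑ h ∈ Finset.range H, expi x ^ h) / (expi x - 1) / (q * H)

section shiftWeight

variable {q H : ℕ} {x : ℝ}

lemma shiftWeight_mul_sub_one (hq : q ≠ 0) (hH : H ≠ 0) (hx : expi x ≠ 1) (t : ℕ) :
    expi x * (∑ h ∈ Finset.range H, expi x ^ h) * ∑ n ∈ Finset.range t, expi x ^ n =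
      q * H * (shiftWeight q H x * (expi (t * x) - 1)) := by
  have hq' : (q : ℂ) ≠ 0 := by exact_mod_cast hq
  have hH' : (H : ℂ) ≠ 0 := by exact_mod_cast hH
  have h1 : expi x - 1 ≠ 0 := sub_ne_zero.2 hx
  rw [geom_sum_eq hx t, shiftWeight, expi_natCast_mul]
  field_simp

lemma norm_shiftWeight_le (hq : 0 < q) (hH : 0 < H) (hx0 : x ≠ 0) (hx : |x| ≤ 1 / 2) :
    ‖shiftWeight q H x‖ ≤ 1 / (q * |x|) := by
  have h1 := four_mul_abs_le_norm_expi_sub_one hx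
  have hx' : 0 < |x| := abs_pos.2 hx0
  have hq' : (0 : ℝ) < q := by exact_mod_cast hq
  have hH' : (0 : ℝ) < H := by exact_mod_cast hH
  have h2 : ‖∑ h ∈ Finset.range H, expi x ^ h‖ ≤ H := by
    refine (norm_sum_le_of_le _ (n := fun _ => 1) fun h _ => ?_).trans (by simp)
    rw [norm_pow, norm_expi, one_pow]
  rw [shiftWeight, norm_div, norm_div, norm_mul, norm_expi, one_mul, norm_mul,
    Complex.norm_natCast, Complex.norm_natCast]
  calc ‖∑ h ∈ Finset.range H, expi x ^ h‖ / ‖expi x - 1‖ / (q * H)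
      ≤ H / |x| / (q * H) := by
        gcongr
        linarith
    _ = 1 / (q * |x|) := by field_simp

/-- Here the sum over shifts is bounded as a geometric series instead of by `H`; this is the extra
decay gained by averaging. -/
lemma norm_shiftWeight_le' (hq : 0 < q) (hH : 0 < H) (hx0 : x ≠ 0) (hx : |x| ≤ 1 / 2) :
    ‖shiftWeight q H x‖ ≤ 1 / (8 * q * H * |x| ^ 2) := by
  have h1 := four_mul_abs_le_norm_expi_sub_one hx
  have hx' : 0 < |x| := abs_pos.2 hx0
  have hq' : (0 : ℝ) < q := by exact_mod_cast hq
  have hH' : (0 : ℝ) < H := by exact_mod_cast hH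
  have h0 : 0 < ‖expi x - 1‖ := by linarith
  have hne : expi x ≠ 1 := fun h => by simp [h] at h0
  have h2 : ‖∑ h ∈ Finset.range H, expi x ^ h‖ ≤ 2 / (4 * |x|) := by
    rw [geom_sum_eq hne, norm_div]
    gcongr
    refine (norm_sub_le _ _).trans ?_
    rw [norm_pow, norm_expi, one_pow, norm_one]
    norm_num
  rw [shiftWeight, norm_div, norm_div, norm_mul, norm_expi, one_mul, norm_mul,
    Complex.norm_natCast, Complex.norm_natCast]
  calc ‖∑ h ∈ Finset.range H, expi x ^ h‖ / ‖expi x - 1‖ / (q * H)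
      ≤ 2 / (4 * |x|) / (4 * |x|) / (q * H) := by gcongr
    _ = 1 / (8 * q * H * |x| ^ 2) := by
        field_simp
        norm_num

end shiftWeight

/-- The Fourier weight at the frequency `s * m`, where `s = ±1`. -/
noncomputable def signedWeight (q H : ℕ) (s : ℤ) (m : ℕ) : ℂ :=
  if 2 * m ≤ q then shiftWeight q H (s * m / q) else 0

section signedWeight

variable {q H : ℕ} {s : ℤ}

lemma abs_sign_mul_div (hs : |s| = 1) (m : ℕ) : |((s : ℝ) * m / q)| = m / q := by
  have : |(s : ℝ)| = 1 := by exact_mod_cast congrArg (Int.cast (R := ℝ)) hs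
  rw [abs_div, abs_mul, this, one_mul, Nat.abs_cast, Nat.abs_cast]

lemma sign_mul_div_bounds (hq : 0 < q) (hs : |s| = 1) {m : ℕ} (hm : m ≠ 0) (hmq : 2 * m ≤ q) :
    (s : ℝ) * m / q ≠ 0 ∧ |(s : ℝ) * m / q| ≤ 1 / 2 := by
  have hq' : (0 : ℝ) < q := by exact_mod_cast hq
  have hm' : (0 : ℝ) < m := by exact_mod_cast Nat.pos_of_ne_zero hm
  have hmq' : (2 : ℝ) * m ≤ q := by exact_mod_cast hmq
  rw [← abs_pos, abs_sign_mul_div hs]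
  refine ⟨by positivity, ?_⟩
  rw [div_le_div_iff₀ hq' (by norm_num)]
  linarith

/-- Cutting the weight off at `2 * m > q` makes the bound valid for every `m ≠ 0`, as the moment
estimate demands. -/
lemma norm_signedWeight_le (hq : 0 < q) (hH : 0 < H) (hs : |s| = 1) {m : ℕ} (hm : m ≠ 0) :
    ‖signedWeight q H s m‖ ≤ 1 / m := by
  have hq' : (0 : ℝ) < q := by exact_mod_cast hq
  rw [signedWeight]
  split_ifs with h
  · obtain ⟨h0, h1⟩ := sign_mul_div_bounds hq hs hm h
    refine (norm_shiftWeight_le hq hH h0 h1).trans (le_of_eq ?_)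
    rw [abs_sign_mul_div hs]
    field_simp
  · rw [norm_zero]
    positivity

lemma norm_signedWeight_le' (hq : 0 < q) (hH : 0 < H) (hs : |s| = 1) {m : ℕ} (hm : m ≠ 0) :
    ‖signedWeight q H s m‖ ≤ q / (8 * H) * ((m : ℝ) ^ 2)⁻¹ := by
  have hq' : (0 : ℝ) < q := by exact_mod_cast hq
  have hH' : (0 : ℝ) < H := by exact_mod_cast hH
  have hm' : (0 : ℝ) < m := by exact_mod_cast Nat.pos_of_ne_zero hm
  rw [signedWeight]
  split_ifs with h
  · obtain ⟨h0, h1⟩ := sign_mul_div_bounds hq hs hm h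
    refine (norm_shiftWeight_le' hq hH h0 h1).trans (le_of_eq ?_)
    rw [abs_sign_mul_div hs]
    field_simp
  · rw [norm_zero]
    positivity

lemma norm_sum_signedWeight_le [NeZero q] (hH : 0 < H) (hs : |s| = 1)
    (χ : DirichletCharacter ℂ q) {Y N : ℕ} (hY : 0 < Y) (hYN : Y ≤ N) (y : ℝ) :
    ‖∑ m ∈ Finset.Icc 1 N, signedWeight q H s m * (expi (m * y) - 1) * χ m‖ ≤
      ‖∑ m ∈ Finset.Icc 1 Y, signedWeight q H s m * expi (m * y) * χ m‖ +
      ‖∑ m ∈ Finset.Icc 1 Y, signedWeight q H s m * expi (m * 0) * χ m‖ + q / (4 * H * Y) := by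
  have hq := NeZero.pos q
  have hH' : (0 : ℝ) < H := by exact_mod_cast hH
  have hY' : (0 : ℝ) < Y := by exact_mod_cast hY
  have hsplit : Finset.Icc 1 N = Finset.Icc 1 Y ∪ Finset.Ioc Y N := by
    ext n
    simp only [Finset.mem_union, Finset.mem_Icc, Finset.mem_Ioc]
    omega
  have hdisj : Disjoint (Finset.Icc 1 Y) (Finset.Ioc Y N) := by
    rw [Finset.disjoint_left]
    intro n hn hn'
    rw [Finset.mem_Icc] at hn
    rw [Finset.mem_Ioc] at hn'
    omega
  rw [hsplit, Finset.sum_union hdisj]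
  refine (norm_add_le _ _).trans (add_le_add ?_ ?_)
  · rw [show ∑ m ∈ Finset.Icc 1 Y, signedWeight q H s m * (expi (m * y) - 1) * χ m =
      ∑ m ∈ Finset.Icc 1 Y, signedWeight q H s m * expi (m * y) * χ m -
      ∑ m ∈ Finset.Icc 1 Y, signedWeight q H s m * expi (m * 0) * χ m by
        rw [← Finset.sum_sub_distrib]
        refine Finset.sum_congr rfl fun m _ => ?_
        rw [mul_zero, expi_zero]
        ring]
    exact norm_sub_le _ _
  · calc ‖∑ m ∈ Finset.Ioc Y N, signedWeight q H s m * (expi (m * y) - 1) * χ m‖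
        ≤ ∑ m ∈ Finset.Ioc Y N, q / (4 * H) * ((m : ℝ) ^ 2)⁻¹ := by
          refine norm_sum_le_of_le _ fun m hm => ?_
          have hm0 : m ≠ 0 := by
            rw [Finset.mem_Ioc] at hm
            omega
          have h1 : ‖expi (m * y) - 1‖ ≤ 2 := by
            refine (norm_sub_le _ _).trans ?_
            rw [norm_expi, norm_one]
            norm_num
          rw [norm_mul, norm_mul]
          calc ‖signedWeight q H s m‖ * ‖expi (m * y) - 1‖ * ‖χ m‖
              ≤ q / (8 * H) * ((m : ℝ) ^ 2)⁻¹ * 2 * 1 := by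
                gcongr
                · exact norm_signedWeight_le' hq hH hs hm0
                · exact χ.norm_le_one _
            _ = _ := by field_simp; norm_num
      _ ≤ q / (4 * H) * (Y : ℝ)⁻¹ := by
          rw [← Finset.mul_sum]
          gcongr
          refine (sum_Ioc_inv_sq_le_sub hY.ne' hYN).trans ?_
          have : (0 : ℝ) ≤ (N : ℝ)⁻¹ := by positivity
          linarith
      _ = _ := by field_simp

end signedWeight

/-- Each unit shift of the interval only exchanges one endpoint term for another. -/
lemma norm_charSum_sub_shift_le {q : ℕ} (χ : DirichletCharacter ℂ q) (t h : ℕ) :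
    ‖charSum χ t - ∑ n ∈ Finset.range t, χ ((h + 1 + n : ℕ) : ZMod q)‖ ≤ 2 * h := by
  have e : charSum χ t = ∑ n ∈ Finset.range t, χ ((1 + n : ℕ) : ZMod q) := by
    rw [charSum, Nat.floor_natCast, Finset.range_eq_Ico,
      Finset.sum_Ico_add (fun n : ℕ => χ (n : ZMod q)) 0 t 1]
    rfl
  rw [e]
  induction h with
  | zero => simp
  | succ h ih =>
    have hshift : ∑ n ∈ Finset.range t, χ ((h + 1 + n : ℕ) : ZMod q) -
        ∑ n ∈ Finset.range t, χ ((h + 1 + 1 + n : ℕ) : ZMod q) =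
        χ ((h + 1 + 0 : ℕ) : ZMod q) - χ ((h + 1 + t : ℕ) : ZMod q) := by
      rw [← Finset.sum_range_sub' (fun n : ℕ => χ ((h + 1 + n : ℕ) : ZMod q)),
        Finset.sum_sub_distrib]
      congr 1
      exact Finset.sum_congr rfl fun n _ => by congr 2; ring
    have h2 : ‖∑ n ∈ Finset.range t, χ ((h + 1 + n : ℕ) : ZMod q) -
        ∑ n ∈ Finset.range t, χ ((h + 1 + 1 + n : ℕ) : ZMod q)‖ ≤ 2 := by
      rw [hshift]
      refine (norm_sub_le _ _).trans ?_
      have h1 := χ.norm_le_one ((h + 1 + 0 : ℕ) : ZMod q)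
      have h2 := χ.norm_le_one ((h + 1 + t : ℕ) : ZMod q)
      linarith
    have h3 := norm_sub_le_norm_sub_add_norm_sub
      (∑ n ∈ Finset.range t, χ ((1 + n : ℕ) : ZMod q))
      (∑ n ∈ Finset.range t, χ ((h + 1 + n : ℕ) : ZMod q))
      (∑ n ∈ Finset.range t, χ ((h + 1 + 1 + n : ℕ) : ZMod q))
    push_cast at *
    linarith

/-- A truncated Fourier expansion: up to `O(H + q ^ (3 / 2) / (H Y))`, the sum of `χ⁻¹` is `√q`
times exponential sums of length `Y` with coefficients `χ m` and logarithmic weights. -/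
lemma norm_charSum_inv_le {q H Y : ℕ} [NeZero q] {χ : DirichletCharacter ℂ q}
    (hχ : χ.IsPrimitive) (hq : q ≠ 1) (hH : 0 < H) (hY : 0 < Y) (hYq : Y ≤ (q - 1) / 2) (t : ℕ) :
    ‖charSum χ⁻¹ t‖ ≤ 2 * H + Real.sqrt q * (q / (2 * H * Y) +
      ((‖∑ m ∈ Finset.Icc 1 Y, signedWeight q H 1 m * expi (m * (t / q)) * χ m‖ +
        ‖∑ m ∈ Finset.Icc 1 Y, signedWeight q H 1 m * expi (m * 0) * χ m‖) +
      (‖∑ m ∈ Finset.Icc 1 Y, signedWeight q H (-1) m * expi (m * (-t / q)) * χ m‖ +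
        ‖∑ m ∈ Finset.Icc 1 Y, signedWeight q H (-1) m * expi (m * 0) * χ m‖))) := by
  have hq0 := NeZero.pos q
  have hq' : (0 : ℝ) < q := by exact_mod_cast hq0
  have hH' : (0 : ℝ) < H := by exact_mod_cast hH
  have hY' : (0 : ℝ) < Y := by exact_mod_cast hY
  set g := gaussSum χ ZMod.stdAddChar with hg
  have hgn : ‖g‖ = Real.sqrt q := norm_gaussSum_of_isPrimitive hχ
  set D : ℂ := ∑ h ∈ Finset.range H, ∑ n ∈ Finset.range t, χ⁻¹ ((h + 1 + n : ℕ) : ZMod q) with hD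
  have h1 : ‖(H : ℂ) * charSum χ⁻¹ t - D‖ ≤ H * (2 * H) := by
    have e : (H : ℂ) * charSum χ⁻¹ t - D = ∑ h ∈ Finset.range H,
        (charSum χ⁻¹ t - ∑ n ∈ Finset.range t, χ⁻¹ ((h + 1 + n : ℕ) : ZMod q)) := by
      rw [Finset.sum_sub_distrib, Finset.sum_const, Finset.card_range, nsmul_eq_mul]
    rw [e]
    refine (norm_sum_le_of_le _ (n := fun _ => (2 * H : ℝ)) fun h hh => ?_).trans (by simp)
    refine (norm_charSum_sub_shift_le χ⁻¹ t h).trans ?_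
    have : (h : ℝ) ≤ H := by exact_mod_cast (Finset.mem_range.1 hh).le
    linarith
  let F : ZMod q → ℂ := fun j => χ j * (ZMod.stdAddChar j *
    (∑ h ∈ Finset.range H, ZMod.stdAddChar j ^ h) * ∑ n ∈ Finset.range t, ZMod.stdAddChar j ^ n)
  -- Expanding `χ⁻¹ (h + 1 + n)` by the Gauss sum separates `h` from `n`, leaving a product of two
  -- geometric sums at each frequency.
  have h2 : D * g = ∑ j : ZMod q, F j := by
    rw [hD, Finset.sum_mul]
    simp_rw [Finset.sum_mul, hg, inv_apply_mul_gaussSum hχ]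
    rw [Finset.sum_congr rfl fun h _ => Finset.sum_comm, Finset.sum_comm]
    refine Finset.sum_congr rfl fun j _ => ?_
    simp only [F]
    rw [mul_assoc, Finset.sum_mul_sum, Finset.mul_sum, Finset.mul_sum]
    refine Finset.sum_congr rfl fun h _ => ?_
    rw [Finset.mul_sum, Finset.mul_sum]
    refine Finset.sum_congr rfl fun n _ => ?_
    ring
  have hF : ∀ s : ℤ, |s| = 1 → ∀ m : ℕ, m ≠ 0 → 2 * m ≤ q → F ((s * m : ℤ) : ZMod q) =
      q * H * (χ (s : ZMod q) *
        (signedWeight q H s m * (expi (m * (s * t / q)) - 1) * χ m)) := by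
    intro s hs m hm hmq
    obtain ⟨hx0, hx⟩ := sign_mul_div_bounds hq0 hs hm hmq
    have hne : expi (s * m / q) ≠ 1 := by
      intro h
      have h3 := four_mul_abs_le_norm_expi_sub_one hx
      rw [h, sub_self, norm_zero] at h3
      have := abs_pos.2 hx0
      linarith
    simp only [F]
    rw [stdAddChar_intCast, signedWeight, if_pos hmq]
    push_cast
    rw [shiftWeight_mul_sub_one hq0.ne' hH.ne' hne t, map_mul,
      show (t : ℝ) * (s * m / q) = m * (s * t / q) by ring]
    ring
  have hhalf : ∀ s : ℤ, |s| = 1 → ∀ N : ℕ, Y ≤ N → 2 * N ≤ q →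
      ‖∑ m ∈ Finset.Icc 1 N, F ((s * m : ℤ) : ZMod q)‖ ≤ q * H *
        (‖∑ m ∈ Finset.Icc 1 Y, signedWeight q H s m * expi (m * (s * t / q)) * χ m‖ +
        ‖∑ m ∈ Finset.Icc 1 Y, signedWeight q H s m * expi (m * 0) * χ m‖ +
        q / (4 * H * Y)) := by
    intro s hs N hYN hN
    have e : ∑ m ∈ Finset.Icc 1 N, F ((s * m : ℤ) : ZMod q) = q * H * (χ (s : ZMod q) *
        ∑ m ∈ Finset.Icc 1 N, signedWeight q H s m * (expi (m * (s * t / q)) - 1) * χ m) := by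
      rw [Finset.mul_sum, Finset.mul_sum]
      refine Finset.sum_congr rfl fun m hm => hF s hs m ?_ ?_
      · have := (Finset.mem_Icc.1 hm).1
        omega
      · have := (Finset.mem_Icc.1 hm).2
        omega
    rw [e, norm_mul, norm_mul, norm_mul, Complex.norm_natCast, Complex.norm_natCast]
    gcongr
    refine (mul_le_of_le_one_left (norm_nonneg _) (χ.norm_le_one _)).trans ?_
    exact norm_sum_signedWeight_le hH hs χ hY hYN _
  have h3 := sum_zmod_eq F
  have hF0 : F 0 = 0 := by
    have : Nontrivial (ZMod q) := ZMod.nontrivial_iff.2 hq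
    simp only [F]
    rw [χ.map_nonunit not_isUnit_zero, zero_mul]
  have h4 := hhalf 1 (by simp) (q / 2) (by omega) (by omega)
  have h5 := hhalf (-1) (by simp) ((q - 1) / 2) (by omega) (by omega)
  simp only [one_mul, neg_one_mul, Int.cast_one, Int.cast_neg] at h4 h5
  set G1 := ‖∑ m ∈ Finset.Icc 1 Y, signedWeight q H 1 m * expi (m * (t / q)) * χ m‖
  set G2 := ‖∑ m ∈ Finset.Icc 1 Y, signedWeight q H 1 m * expi (m * 0) * χ m‖
  set G3 := ‖∑ m ∈ Finset.Icc 1 Y, signedWeight q H (-1) m * expi (m * (-t / q)) * χ m‖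
  set G4 := ‖∑ m ∈ Finset.Icc 1 Y, signedWeight q H (-1) m * expi (m * 0) * χ m‖
  have h6 : ‖D‖ * Real.sqrt q ≤
      q * H * (G1 + G2 + q / (4 * H * Y)) + q * H * (G3 + G4 + q / (4 * H * Y)) := by
    rw [← hgn, ← norm_mul, h2, h3, hF0, zero_add]
    refine (norm_add_le _ _).trans (add_le_add h4 ?_)
    simpa only [Int.cast_neg] using h5
  have h7 : H * ‖charSum χ⁻¹ t‖ ≤ H * (2 * H) + ‖D‖ := by
    have := norm_sub_norm_le ((H : ℂ) * charSum χ⁻¹ t) D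
    rw [norm_mul, Complex.norm_natCast] at this
    linarith
  have hsq : 0 < Real.sqrt q := Real.sqrt_pos.2 hq'
  have hss : Real.sqrt q * Real.sqrt q = q := Real.mul_self_sqrt hq'.le
  have h8 : ‖D‖ ≤ H * (Real.sqrt q * (q / (2 * H * Y) + ((G1 + G2) + (G3 + G4)))) := by
    refine le_of_mul_le_mul_right ?_ hsq
    refine h6.trans (le_of_eq ?_)
    rw [show (q : ℝ) / (2 * H * Y) = q / (4 * H * Y) + q / (4 * H * Y) by field_simp; norm_num]
    linear_combination (H : ℝ) * (q / (4 * H * Y) + q / (4 * H * Y) + ((G1 + G2) + (G3 + G4))) *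
      (-hss)
  refine le_of_mul_le_mul_left ?_ hH'
  rw [mul_add]
  linarith

/-! ### Moments over primitive characters -/

lemma exists_natCast_norm_charSum_eq {q : ℕ} [NeZero q] {χ : DirichletCharacter ℂ q} (hχ : χ ≠ 1) :
    ∃ t : ℕ, ‖charSum χ t‖ = maxCharSum χ := by
  obtain ⟨t, ht⟩ := (isGreatest_maxCharSum hχ).1
  refine ⟨⌊t⌋₊, ?_⟩
  rw [← ht]
  simp [charSum]

lemma norm_charSum_le_maxCharSum {q : ℕ} [NeZero q] {χ : DirichletCharacter ℂ q} (hχ : χ ≠ 1)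
    (t : ℝ) : ‖charSum χ t‖ ≤ maxCharSum χ :=
  (isGreatest_maxCharSum hχ).2 ⟨t, rfl⟩

lemma maxCharSum_nonneg {q : ℕ} (χ : DirichletCharacter ℂ q) : 0 ≤ maxCharSum χ :=
  Real.iSup_nonneg fun _ => norm_nonneg _

lemma one_le_log_of_three_le {x : ℝ} (hx : 3 ≤ x) : 1 ≤ Real.log x := by
  rw [Real.le_log_iff_exp_le (by linarith)]
  linarith [Real.exp_one_lt_three]

lemma isPrimitive_inv_iff {q : ℕ} (χ : DirichletCharacter ℂ q) :
    χ⁻¹.IsPrimitive ↔ χ.IsPrimitive := by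
  rw [DirichletCharacter.isPrimitive_def, DirichletCharacter.isPrimitive_def,
    DirichletCharacter.conductor_inv]

open scoped Classical in
lemma exists_sum_isPrimitive_maxCharSum_pow_le : ∃ C : ℝ, 0 < C ∧ ∀ K : ℕ, 4 ≤ K → ∃ q₀ : ℕ,
    ∀ (q : ℕ) [NeZero q], q₀ ≤ q →
    ∑ ψ : DirichletCharacter ℂ q with ψ.IsPrimitive, maxCharSum ψ ^ (2 * K) ≤
      q.totient * (Real.sqrt q * (C * Real.log K ^ 2)) ^ (2 * K) := by
  obtain ⟨C, hC, hmain⟩ := exists_sum_norm_logWeight_pow_le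
  -- Four exponential sums contribute `C` each. The shift and truncation errors, with `H = Y` just
  -- above `√q`, are at most `5√q`.
  refine ⟨5 + 4 * C, by positivity, fun K hK => ?_⟩
  obtain ⟨q₀, hq₀⟩ := hmain K hK
  refine ⟨max q₀ 100, fun q _ hq => ?_⟩
  have hq1 : q₀ ≤ q := (le_max_left _ _).trans hq
  have hq2 : 100 ≤ q := (le_max_right _ _).trans hq
  have hq' : (0 : ℝ) < q := by exact_mod_cast NeZero.pos q
  have hqne : q ≠ 1 := by omega
  set Y := Nat.sqrt q + 1 with hYdef
  have hs1 : Nat.sqrt q * Nat.sqrt q ≤ q := Nat.sqrt_le q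
  have hs2 : q < Y * Y := Nat.lt_succ_sqrt q
  have hs3 : 10 ≤ Nat.sqrt q := Nat.le_sqrt.2 (by omega)
  have hY0 : 0 < Y := Nat.succ_pos _
  have hYq : Y ≤ (q - 1) / 2 := by
    rw [Nat.le_div_iff_mul_le (by norm_num)]
    have : 10 * Nat.sqrt q ≤ q := (Nat.mul_le_mul_right _ hs3).trans hs1
    omega
  have hYsq : Y ^ 2 ≤ 16 * q := by nlinarith
  have hex : ∀ χ : DirichletCharacter ℂ q, ∃ t : ℕ, χ.IsPrimitive →
      ‖charSum χ⁻¹ t‖ = maxCharSum χ⁻¹ := by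
    intro χ
    by_cases hχ : χ.IsPrimitive
    · have h1 : χ⁻¹ ≠ 1 := by
        intro h
        rw [inv_eq_one] at h
        rw [DirichletCharacter.isPrimitive_def, h, DirichletCharacter.conductor_one] at hχ
        omega
      obtain ⟨t, ht⟩ := exists_natCast_norm_charSum_eq h1
      exact ⟨t, fun _ => ht⟩
    · exact ⟨0, fun h => absurd h hχ⟩
  choose t ht using hex
  let G : ℤ → (DirichletCharacter ℂ q → ℝ) → DirichletCharacter ℂ q → ℝ := fun s θ χ =>
    ‖∑ m ∈ Finset.Icc 1 Y, signedWeight q Y s m * expi (m * θ χ) * χ m‖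
  have hG : ∀ s : ℤ, |s| = 1 → ∀ θ, ∑ χ : DirichletCharacter ℂ q, G s θ χ ^ (2 * K) ≤
      q.totient * (C * Real.log K ^ 2) ^ (2 * K) := fun s hs θ =>
    hq₀ q hq1 Y hYsq (signedWeight q Y s)
      (fun m hm => norm_signedWeight_le (NeZero.pos q) hY0 hs hm) θ
  have hsq : 0 < Real.sqrt q := Real.sqrt_pos.2 hq'
  have hss : Real.sqrt q * Real.sqrt q = q := Real.mul_self_sqrt hq'.le
  let R : DirichletCharacter ℂ q → ℝ := fun χ =>
    5 + ((G 1 (fun χ => t χ / q) χ + G 1 (fun _ => 0) χ) +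
      (G (-1) (fun χ => -t χ / q) χ + G (-1) (fun _ => 0) χ))
  have hR0 : ∀ χ, 0 ≤ R χ := fun χ => by positivity
  have hle : ∀ χ : DirichletCharacter ℂ q, χ.IsPrimitive →
      maxCharSum χ⁻¹ ≤ Real.sqrt q * R χ := by
    intro χ hχ
    rw [← ht χ hχ]
    refine (norm_charSum_inv_le hχ hqne hY0 hY0 hYq (t χ)).trans ?_
    simp only [R]
    rw [mul_add _ (5 : ℝ), mul_add (Real.sqrt q) (q / _), ← add_assoc]
    refine add_le_add ?_ le_rfl
    have h1 : (Nat.sqrt q : ℝ) ≤ Real.sqrt q := Real.nat_sqrt_le_real_sqrt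
    have h2 : (10 : ℝ) ≤ Nat.sqrt q := by exact_mod_cast hs3
    have h3 : (Y : ℝ) = Nat.sqrt q + 1 := by push_cast [hYdef]; ring
    have h4 : (q : ℝ) / (2 * Y * Y) ≤ 1 / 2 := by
      rw [div_le_div_iff₀ (by positivity) (by norm_num)]
      have : (q : ℝ) ≤ Y * Y := by exact_mod_cast hs2.le
      linarith
    nlinarith
  have hlog : 1 ≤ Real.log K := one_le_log_of_three_le (by
    have : (4 : ℝ) ≤ K := by exact_mod_cast hK
    linarith)
  have hsumR : ∑ χ : DirichletCharacter ℂ q, R χ ^ (2 * K) ≤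
      q.totient * ((5 + 4 * C) * Real.log K ^ 2) ^ (2 * K) := by
    set Z := C * Real.log K ^ 2
    have hZ : 0 ≤ Z := by positivity
    have hn : 2 * K ≠ 0 := by omega
    have hφ : (0 : ℝ) ≤ q.totient := Nat.cast_nonneg _
    have hcard : ∑ _χ : DirichletCharacter ℂ q, (5 : ℝ) ^ (2 * K) ≤ q.totient * 5 ^ (2 * K) := by
      rw [Finset.sum_const, Finset.card_univ, nsmul_eq_mul, ← Nat.card_eq_fintype_card,
        DirichletCharacter.card_eq_totient_of_hasEnoughRootsOfUnity]
    have hG0 : ∀ s θ, ∀ χ ∈ (Finset.univ : Finset (DirichletCharacter ℂ q)), 0 ≤ G s θ χ :=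
      fun s θ χ _ => norm_nonneg _
    have hp := sum_add_pow_le _ hn hφ hZ hZ (hG0 1 fun χ => t χ / q) (hG0 1 fun _ => 0)
      (hG 1 (by simp) _) (hG 1 (by simp) _)
    have hm := sum_add_pow_le _ hn hφ hZ hZ (hG0 (-1) fun χ => -t χ / q) (hG0 (-1) fun _ => 0)
      (hG (-1) (by simp) _) (hG (-1) (by simp) _)
    have hpm := sum_add_pow_le _ hn hφ (add_nonneg hZ hZ) (add_nonneg hZ hZ)
      (fun χ _ => by positivity) (fun χ _ => by positivity) hp hm
    refine (sum_add_pow_le _ hn hφ (by norm_num) (by positivity) (fun _ _ => by norm_num)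
      (fun χ _ => by positivity) hcard hpm).trans ?_
    gcongr
    simp only [Z]
    nlinarith [one_le_pow₀ hlog (n := 2)]
  calc ∑ ψ : DirichletCharacter ℂ q with ψ.IsPrimitive, maxCharSum ψ ^ (2 * K)
      -- The Fourier expansion bounds the sum of `χ⁻¹` by sums with `χ`; inversion permutes the
      -- primitive characters.
      = ∑ χ : DirichletCharacter ℂ q with χ.IsPrimitive, maxCharSum χ⁻¹ ^ (2 * K) := by
        refine Finset.sum_nbij' (fun ψ => ψ⁻¹) (fun ψ => ψ⁻¹) ?_ ?_ ?_ ?_ ?_ <;>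
          simp [isPrimitive_inv_iff]
    _ ≤ ∑ χ : DirichletCharacter ℂ q with χ.IsPrimitive, (Real.sqrt q * R χ) ^ (2 * K) :=
        Finset.sum_le_sum fun χ hχ => pow_le_pow_left₀ (maxCharSum_nonneg _)
          (hle χ (Finset.mem_filter.1 hχ).2) _
    _ ≤ ∑ χ : DirichletCharacter ℂ q, (Real.sqrt q * R χ) ^ (2 * K) :=
        Finset.sum_le_sum_of_subset_of_nonneg (Finset.filter_subset _ _) fun χ _ _ =>
          pow_nonneg (mul_nonneg hsq.le (hR0 χ)) _
    _ ≤ _ := by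
        simp only [mul_pow (Real.sqrt q)]
        rw [← Finset.mul_sum, mul_left_comm]
        gcongr

/-! ### Reduction to primitive characters -/

lemma sum_divisors_moebius (n : ℕ) :
    ∑ e ∈ n.divisors, ArithmeticFunction.moebius e = if n = 1 then 1 else 0 := by
  rw [← ArithmeticFunction.coe_mul_zeta_apply, ArithmeticFunction.moebius_mul_coe_zeta,
    ArithmeticFunction.one_apply]

/-- Since `ψ n` already vanishes unless `n` is coprime to `d`, only coprimality to `q / d` has to be
detected, by Möbius inversion. -/
lemma changeLevel_natCast_apply {d q : ℕ} [NeZero q] (hd : d ∣ q) (ψ : DirichletCharacter ℂ d)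
    {n : ℕ} (hn : n ≠ 0) :
    DirichletCharacter.changeLevel hd ψ (n : ZMod q) =
      ∑ e ∈ (q / d).divisors, if e ∣ n then (ArithmeticFunction.moebius e : ℂ) * ψ n else 0 := by
  have hq : q ≠ 0 := NeZero.ne q
  have hd0 : d ≠ 0 := fun h => hq (by simpa [h] using hd)
  have hr : q / d ≠ 0 := (Nat.div_pos (Nat.le_of_dvd (NeZero.pos q) hd) (Nat.pos_of_ne_zero hd0)).ne'
  have hqd : q = d * (q / d) := (Nat.mul_div_cancel' hd).symm
  have hcop : ∀ {m : ℕ}, IsCoprime (n : ℤ) (m : ℤ) ↔ n.Coprime m := Nat.isCoprime_iff_coprime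
  have hg : Nat.gcd n (q / d) ≠ 0 := Nat.gcd_ne_zero_left hn
  have hsum : ∑ e ∈ (q / d).divisors,
      (if e ∣ n then (ArithmeticFunction.moebius e : ℂ) * ψ n else 0) =
      (if n.Coprime (q / d) then 1 else 0) * ψ n := by
    rw [← Finset.sum_filter, ← Finset.sum_mul]
    congr 1
    have hf : (q / d).divisors.filter (· ∣ n) = (Nat.gcd n (q / d)).divisors := by
      ext e
      simp only [Finset.mem_filter, Nat.mem_divisors, Nat.dvd_gcd_iff]
      tauto
    rw [hf]
    have := sum_divisors_moebius (Nat.gcd n (q / d))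
    have h2 := congrArg (Int.cast (R := ℂ)) this
    push_cast at h2
    rw [h2]
  rw [hsum]
  by_cases hnq : n.Coprime q
  · have h1 := DirichletCharacter.changeLevel_eq_cast_of_dvd' ψ hd (a := (n : ℤ)) (hcop.2 hnq)
    rw [Int.cast_natCast, Int.cast_natCast] at h1
    rw [h1, if_pos, one_mul]
    rw [hqd] at hnq
    exact Nat.Coprime.coprime_mul_left_right hnq
  · have h1 := (DirichletCharacter.apply_eq_zero_iff
      (DirichletCharacter.changeLevel hd ψ) (n : ℤ)).2 fun h => hnq (hcop.1 h)
    rw [Int.cast_natCast] at h1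
    rw [h1]
    split_ifs with h2
    · have h3 := (DirichletCharacter.apply_eq_zero_iff ψ (n : ℤ)).2 fun h => hnq (by
        rw [hqd]
        exact Nat.Coprime.mul_right (hcop.1 h) h2)
      rw [Int.cast_natCast] at h3
      rw [h3, mul_zero]
    · rw [zero_mul]

lemma sum_filter_dvd_eq_charSum {d : ℕ} (ψ : DirichletCharacter ℂ d) {e : ℕ} (he : e ≠ 0) (T : ℕ) :
    ∑ n ∈ (Finset.Icc 1 T).filter (e ∣ ·), ψ (n : ZMod d) =
      ψ (e : ZMod d) * charSum ψ ((T / e : ℕ) : ℝ) := by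
  rw [charSum, Nat.floor_natCast, Finset.mul_sum]
  symm
  refine Finset.sum_nbij' (fun m => e * m) (fun n => n / e) ?_ ?_ ?_ ?_ ?_
  · intro m hm
    rw [Finset.mem_Icc] at hm
    refine Finset.mem_filter.2 ⟨Finset.mem_Icc.2 ⟨?_, ?_⟩, dvd_mul_right _ _⟩
    · exact Nat.mul_pos (Nat.pos_of_ne_zero he) hm.1
    · rw [mul_comm]
      exact (Nat.le_div_iff_mul_le (Nat.pos_of_ne_zero he)).1 hm.2
  · intro n hn
    obtain ⟨hn, hdvd⟩ := Finset.mem_filter.1 hn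
    rw [Finset.mem_Icc] at hn
    exact Finset.mem_Icc.2 ⟨Nat.div_pos (Nat.le_of_dvd hn.1 hdvd) (Nat.pos_of_ne_zero he),
      Nat.div_le_div_right hn.2⟩
  · intro m _
    exact Nat.mul_div_cancel_left m (Nat.pos_of_ne_zero he)
  · intro n hn
    exact Nat.mul_div_cancel' (Finset.mem_filter.1 hn).2
  · intro m _
    rw [Nat.cast_mul, map_mul]

lemma maxCharSum_changeLevel_le {d q : ℕ} [NeZero q] [NeZero d] (hd : d ∣ q)
    {ψ : DirichletCharacter ℂ d} (hψ : ψ ≠ 1) :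
    maxCharSum (DirichletCharacter.changeLevel hd ψ) ≤ (q / d).divisors.card * maxCharSum ψ := by
  refine ciSup_le fun t => ?_
  have e : charSum (DirichletCharacter.changeLevel hd ψ) t =
      ∑ e ∈ (q / d).divisors, (ArithmeticFunction.moebius e : ℂ) *
        (ψ (e : ZMod d) * charSum ψ ((⌊t⌋₊ / e : ℕ) : ℝ)) := by
    rw [charSum, Finset.sum_congr rfl fun n hn => changeLevel_natCast_apply hd ψ
      (by have := (Finset.mem_Icc.1 hn).1; omega), Finset.sum_comm]
    refine Finset.sum_congr rfl fun e he => ?_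
    rw [← sum_filter_dvd_eq_charSum ψ (Nat.pos_of_mem_divisors he).ne', Finset.mul_sum,
      Finset.sum_filter]
  rw [e, ← nsmul_eq_mul]
  refine (norm_sum_le _ _).trans (Finset.sum_le_card_nsmul _ _ _ fun e _ => ?_)
  rw [norm_mul, norm_mul]
  have h1 : ‖(ArithmeticFunction.moebius e : ℂ)‖ ≤ 1 := by
    rw [Complex.norm_intCast]
    exact_mod_cast ArithmeticFunction.abs_moebius_le_one
  have h2 := ψ.norm_le_one (e : ZMod d)
  have h3 := norm_charSum_le_maxCharSum hψ ((⌊t⌋₊ / e : ℕ) : ℝ)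
  calc _ ≤ 1 * (1 * maxCharSum ψ) := by gcongr
    _ = maxCharSum ψ := by ring

open scoped Classical in
-- Group the characters by conductor; each is induced from its primitive character.
lemma sum_maxCharSum_pow_le_sum_divisors {q : ℕ} [NeZero q] (n : ℕ) :
    ∑ χ : DirichletCharacter ℂ q with χ ≠ 1, maxCharSum χ ^ n ≤
      ∑ d ∈ q.divisors, ((q / d).divisors.card : ℝ) ^ n *
        ∑ ψ : DirichletCharacter ℂ d with ψ.IsPrimitive, maxCharSum ψ ^ n := by
  have hmaps : ∀ χ ∈ Finset.univ.filter fun χ : DirichletCharacter ℂ q => χ ≠ 1,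
      χ.conductor ∈ q.divisors := fun χ _ =>
    Nat.mem_divisors.2 ⟨DirichletCharacter.conductor_dvd_level χ, NeZero.ne q⟩
  rw [← Finset.sum_fiberwise_of_maps_to hmaps]
  refine Finset.sum_le_sum fun d hd => ?_
  have hdq := Nat.dvd_of_mem_divisors hd
  have : NeZero d := ⟨(Nat.pos_of_mem_divisors hd).ne'⟩
  have hinj := DirichletCharacter.changeLevel_injective (R := ℂ) hdq
  calc ∑ χ ∈ (Finset.univ.filter fun χ : DirichletCharacter ℂ q => χ ≠ 1).filter
          fun χ => χ.conductor = d, maxCharSum χ ^ n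
      ≤ ∑ χ ∈ (Finset.univ.filter fun ψ : DirichletCharacter ℂ d =>
          ψ.IsPrimitive ∧ ψ ≠ 1).image (DirichletCharacter.changeLevel hdq), maxCharSum χ ^ n := by
        refine Finset.sum_le_sum_of_subset_of_nonneg (fun χ hχ => ?_)
          fun χ _ _ => pow_nonneg (maxCharSum_nonneg χ) n
        obtain ⟨h1, rfl⟩ := Finset.mem_filter.1 hχ
        have h1 := (Finset.mem_filter.1 h1).2
        have h2 := DirichletCharacter.changeLevel_primitiveCharacter χ
        refine Finset.mem_image.2 ⟨χ.primitiveCharacter, Finset.mem_filter.2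
          ⟨Finset.mem_univ _, DirichletCharacter.primitiveCharacter_isPrimitive χ, fun h => ?_⟩, h2⟩
        rw [h, DirichletCharacter.changeLevel_one] at h2
        exact h1 h2.symm
    _ = ∑ ψ : DirichletCharacter ℂ d with ψ.IsPrimitive ∧ ψ ≠ 1,
          maxCharSum (DirichletCharacter.changeLevel hdq ψ) ^ n :=
        Finset.sum_image hinj.injOn
    _ ≤ ∑ ψ : DirichletCharacter ℂ d with ψ.IsPrimitive ∧ ψ ≠ 1,
          ((q / d).divisors.card : ℝ) ^ n * maxCharSum ψ ^ n := by
        refine Finset.sum_le_sum fun ψ hψ => ?_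
        rw [← mul_pow]
        exact pow_le_pow_left₀ (maxCharSum_nonneg _)
          (maxCharSum_changeLevel_le hdq (Finset.mem_filter.1 hψ).2.2) n
    _ ≤ ∑ ψ : DirichletCharacter ℂ d with ψ.IsPrimitive,
          ((q / d).divisors.card : ℝ) ^ n * maxCharSum ψ ^ n := by
        refine Finset.sum_le_sum_of_subset_of_nonneg (fun ψ hψ => ?_)
          fun ψ _ _ => mul_nonneg (by positivity) (pow_nonneg (maxCharSum_nonneg ψ) n)
        exact Finset.mem_filter.2 ⟨Finset.mem_univ _, (Finset.mem_filter.1 hψ).2.1⟩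
    _ = _ := (Finset.mul_sum _ _ _).symm

/-! ### Moments over all nonprincipal characters -/

lemma sum_divisors_inv_sq_le (q : ℕ) : ∑ e ∈ q.divisors, ((e : ℝ) ^ 2)⁻¹ ≤ 2 := by
  rcases Nat.eq_zero_or_pos q with rfl | hq
  · simp
  calc ∑ e ∈ q.divisors, ((e : ℝ) ^ 2)⁻¹ ≤ ∑ e ∈ insert 1 (Finset.Ioc 1 q), ((e : ℝ) ^ 2)⁻¹ := by
        refine Finset.sum_le_sum_of_subset_of_nonneg (fun e he => ?_) fun _ _ _ => by positivity
        have h1 := Nat.pos_of_mem_divisors he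
        have h2 := Nat.divisor_le he
        rw [Finset.mem_insert, Finset.mem_Ioc]
        omega
    _ ≤ 1 + (1 - (q : ℝ)⁻¹) := by
        rw [Finset.sum_insert (by simp)]
        have := sum_Ioc_inv_sq_le_sub (α := ℝ) one_ne_zero (show 1 ≤ q from hq)
        push_cast at this
        simp only [Nat.cast_one, one_pow, inv_one] at this ⊢
        linarith
    _ ≤ 2 := by
        have : (0 : ℝ) ≤ (q : ℝ)⁻¹ := by positivity
        linarith

lemma card_divisors_pow_le (L : ℕ) {n : ℕ} (hn : n ≠ 0) :
    (n.divisors.card : ℝ) ^ (4 * L) ≤ (256 ^ 16 * n) ^ L := by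
  rw [pow_mul]
  gcongr
  exact_mod_cast card_divisors_pow_four_le hn

open scoped Classical in
lemma exists_sum_maxCharSum_pow_le : ∃ C : ℝ, 1 ≤ C ∧ ∀ L : ℕ, 2 ≤ L →
    ∃ q₀ : ℕ, ∀ (q : ℕ) [NeZero q], q₀ ≤ q →
    ∑ χ : DirichletCharacter ℂ q with χ ≠ 1, maxCharSum χ ^ (2 * (2 * L)) ≤
      q.totient * (q : ℝ) ^ (2 * L) * (C * Real.log (2 * L : ℕ) ^ 2) ^ (2 * (2 * L)) := by
  obtain ⟨C, hC, hprim⟩ := exists_sum_isPrimitive_maxCharSum_pow_le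
  refine ⟨3 * (256 ^ 16 * (C + 1)), by nlinarith, fun L hL => ?_⟩
  obtain ⟨d₀, hd₀⟩ := hprim (2 * L) (by omega)
  let P : ℕ → ℝ := fun d => ∑ ψ : DirichletCharacter ℂ d with ψ.IsPrimitive,
    maxCharSum ψ ^ (2 * (2 * L))
  have hP0 : ∀ d, 0 ≤ P d := fun d => Finset.sum_nonneg fun ψ _ => pow_nonneg (maxCharSum_nonneg ψ) _
  -- The primitive estimate is only available for conductors `d ≥ d₀`. The smaller ones contribute
  -- `O(q ^ L)`, negligible against `q ^ (2 * L)`.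
  let B : ℝ := ∑ d ∈ Finset.range d₀, P d
  have hB0 : 0 ≤ B := Finset.sum_nonneg fun d _ => hP0 d
  set Z : ℝ := C * Real.log (2 * L : ℕ) ^ 2 with hZ
  have hlog : 1 ≤ Real.log (2 * L : ℕ) := one_le_log_of_three_le (by
    have : (2 : ℝ) ≤ L := by exact_mod_cast hL
    push_cast
    linarith)
  have hlog2 : 1 ≤ Real.log (2 * L : ℕ) ^ 2 := one_le_pow₀ hlog
  have hZ0 : 0 ≤ Z := by positivity
  set A : ℝ := 256 ^ 16 with hA
  have hA1 : 1 ≤ A := by norm_num [hA]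
  have hsmall : ∀ᶠ q : ℕ in atTop, A ^ L * B ≤ (q : ℝ) ^ L :=
    (((tendsto_pow_atTop (by omega : L ≠ 0)).comp
      (tendsto_natCast_atTop_atTop (R := ℝ))).eventually_ge_atTop (A ^ L * B))
  obtain ⟨q₀, hq₀⟩ := eventually_atTop.1 hsmall
  refine ⟨q₀, fun q _ hqge => ?_⟩
  have hq := hq₀ q hqge
  have hqpos := NeZero.pos q
  have hq' : (0 : ℝ) < q := by exact_mod_cast hqpos
  have hφ : (1 : ℝ) ≤ q.totient := by exact_mod_cast Nat.totient_pos.2 hqpos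
  have hterm : ∀ d ∈ q.divisors, ((q / d).divisors.card : ℝ) ^ (2 * (2 * L)) * P d ≤
      q.totient * (q : ℝ) ^ (2 * L) * (A ^ L * Z ^ (2 * (2 * L))) * (((q / d : ℕ) : ℝ) ^ 2)⁻¹ +
        (if d < d₀ then A ^ L * (q : ℝ) ^ L * P d else 0) := by
    intro d hd
    have hdq := Nat.dvd_of_mem_divisors hd
    have hdpos := Nat.pos_of_mem_divisors hd
    have : NeZero d := ⟨hdpos.ne'⟩
    have hd' : (0 : ℝ) < d := by exact_mod_cast hdpos
    have hepos : 0 < q / d := Nat.div_pos (Nat.divisor_le hd) hdpos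
    have he' : (1 : ℝ) ≤ (q / d : ℕ) := by exact_mod_cast hepos
    have hed : (q : ℝ) = (q / d : ℕ) * d := by exact_mod_cast (Nat.div_mul_cancel hdq).symm
    have hτ : ((q / d).divisors.card : ℝ) ^ (2 * (2 * L)) ≤ (A * (q / d : ℕ)) ^ L := by
      rw [← mul_assoc]
      exact card_divisors_pow_le L hepos.ne'
    by_cases hlt : d < d₀
    · rw [if_pos hlt]
      refine le_add_of_nonneg_of_le (by positivity) ?_
      refine mul_le_mul_of_nonneg_right (hτ.trans ?_) (hP0 d)
      rw [mul_pow]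
      gcongr
      exact Nat.div_le_self q d
    · rw [if_neg hlt, add_zero]
      have h1 : P d ≤ _ := hd₀ d (not_lt.1 hlt)
      have hdtot : (d.totient : ℝ) ≤ q.totient := by
        exact_mod_cast Nat.le_of_dvd (Nat.totient_pos.2 hqpos) (Nat.totient_dvd_of_dvd hdq)
      set e : ℝ := ((q / d : ℕ) : ℝ) with he
      -- The divisor factor costs `e ^ L` with `e = q / d`, while `d ^ (2 * L)` loses `e ^ (2 * L)`;
      -- as `L ≥ 2`, a convergent `e ^ (-2)` remains.
      have hpow : e ^ L * (d : ℝ) ^ (2 * L) ≤ (q : ℝ) ^ (2 * L) * (e ^ 2)⁻¹ := by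
        have h2 : (q : ℝ) ^ (2 * L) * (e ^ 2)⁻¹ = e ^ (2 * L - 2) * (d : ℝ) ^ (2 * L) := by
          rw [hed, mul_pow]
          rw [show (2 * L) = (2 * L - 2) + 2 by omega, pow_add e]
          simp only [Nat.add_sub_cancel]
          field_simp
        rw [h2]
        gcongr
        omega
      calc ((q / d).divisors.card : ℝ) ^ (2 * (2 * L)) * P d
          ≤ (A * e) ^ L * (q.totient * (Real.sqrt d * Z) ^ (2 * (2 * L))) := by
            refine mul_le_mul hτ (h1.trans ?_) (hP0 d) (by positivity)
            gcongr
        _ = q.totient * (A ^ L * Z ^ (2 * (2 * L))) * (e ^ L * (d : ℝ) ^ (2 * L)) := by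
            rw [mul_pow (Real.sqrt d), pow_mul (Real.sqrt d), Real.sq_sqrt hd'.le, mul_pow]
            ring
        _ ≤ q.totient * (A ^ L * Z ^ (2 * (2 * L))) * ((q : ℝ) ^ (2 * L) * (e ^ 2)⁻¹) := by
            gcongr
        _ = _ := by ring
  have hdiv : ∑ d ∈ q.divisors, (((q / d : ℕ) : ℝ) ^ 2)⁻¹ ≤ 2 :=
    (Nat.sum_div_divisors q fun e => ((e : ℝ) ^ 2)⁻¹).trans_le (sum_divisors_inv_sq_le q)
  have hsmallsum : ∑ d ∈ q.divisors, (if d < d₀ then A ^ L * (q : ℝ) ^ L * P d else 0) ≤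
      A ^ L * (q : ℝ) ^ L * B := by
    rw [← Finset.sum_filter, Finset.mul_sum]
    refine Finset.sum_le_sum_of_subset_of_nonneg (fun d hd => ?_)
      fun d _ _ => mul_nonneg (by positivity) (hP0 d)
    exact Finset.mem_range.2 (Finset.mem_filter.1 hd).2
  calc ∑ χ : DirichletCharacter ℂ q with χ ≠ 1, maxCharSum χ ^ (2 * (2 * L))
      ≤ ∑ d ∈ q.divisors, ((q / d).divisors.card : ℝ) ^ (2 * (2 * L)) * P d :=
        sum_maxCharSum_pow_le_sum_divisors _
    _ ≤ q.totient * (q : ℝ) ^ (2 * L) * (A ^ L * Z ^ (2 * (2 * L))) * 2 +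
          A ^ L * (q : ℝ) ^ L * B := by
        refine (Finset.sum_le_sum hterm).trans ?_
        rw [Finset.sum_add_distrib, ← Finset.mul_sum]
        gcongr
    _ ≤ q.totient * (q : ℝ) ^ (2 * L) * (A ^ L * Z ^ (2 * (2 * L))) * 2 +
          q.totient * (q : ℝ) ^ (2 * L) * 1 := by
        refine add_le_add le_rfl ?_
        calc A ^ L * (q : ℝ) ^ L * B = (q : ℝ) ^ L * (A ^ L * B) := by ring
          _ ≤ (q : ℝ) ^ L * (q : ℝ) ^ L := by gcongr
          _ = 1 * (q : ℝ) ^ (2 * L) * 1 := by rw [← pow_add, two_mul]; ring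
          _ ≤ q.totient * (q : ℝ) ^ (2 * L) * 1 := by gcongr
    _ = q.totient * (q : ℝ) ^ (2 * L) * (2 * (A ^ L * Z ^ (2 * (2 * L))) + 1) := by ring
    _ ≤ _ := by
        refine mul_le_mul_of_nonneg_left ?_ (by positivity)
        set X : ℝ := A * ((C + 1) * Real.log (2 * L : ℕ) ^ 2) with hX
        have hX1 : 1 ≤ X := one_le_mul_of_one_le_of_one_le hA1
          (one_le_mul_of_one_le_of_one_le (by linarith) hlog2)
        have h1 : A ^ L * Z ^ (2 * (2 * L)) ≤ X ^ (2 * (2 * L)) := by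
          rw [hX, mul_pow A]
          have : A ^ L ≤ A ^ (2 * (2 * L)) := pow_le_pow_right₀ hA1 (by omega)
          gcongr
          rw [hZ]
          gcongr
          linarith
        have h2 : 1 ≤ X ^ (2 * (2 * L)) := one_le_pow₀ hX1
        have h3 : (3 : ℝ) ≤ 3 ^ (2 * (2 * L)) := le_self_pow₀ (by norm_num) (by omega)
        rw [show 3 * (A * (C + 1)) * Real.log (2 * L : ℕ) ^ 2 = 3 * X by rw [hX]; ring, mul_pow 3]
        nlinarith

open scoped Classical in
-- Power mean inequality with exponent `p = 2 * L / k ≥ 1`, the number of characters being at most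
-- `q.totient`.
lemma exists_moment_le : ∃ C : ℝ, 1 ≤ C ∧ ∀ k : ℝ, 0 < k → ∀ L : ℕ, 2 ≤ L → k ≤ 2 * L →
    ∀ᶠ q : ℕ in atTop,
      moment q k ≤ (C * Real.log (2 * L : ℕ) ^ 2) ^ (2 * k) * (q : ℝ) ^ k := by
  obtain ⟨C, hC, hsum⟩ := exists_sum_maxCharSum_pow_le
  refine ⟨C, hC, fun k hk L hL hkL => ?_⟩
  obtain ⟨q₀, hq₀⟩ := hsum L hL
  filter_upwards [eventually_ge_atTop q₀, eventually_gt_atTop 0] with q hqge hqpos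
  have : NeZero q := ⟨hqpos.ne'⟩
  have hq := hq₀ q hqge
  have hq' : (0 : ℝ) < q := by exact_mod_cast hqpos
  have hφ : (1 : ℝ) ≤ q.totient := by exact_mod_cast Nat.totient_pos.2 hqpos
  have hφ0 : (0 : ℝ) < q.totient := by linarith
  set Z : ℝ := C * Real.log (2 * L : ℕ) ^ 2
  have hZ0 : 0 ≤ Z := by positivity
  set S : Finset (DirichletCharacter ℂ q) := Finset.univ.filter fun χ => χ ≠ 1 with hS
  set p : ℝ := 2 * L / k with hp
  have hp1 : 1 ≤ p := (one_le_div hk).2 hkL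
  have hp0 : 0 < p := by linarith
  have hM0 : ∀ χ ∈ S, 0 ≤ maxCharSum χ ^ (2 * k) := fun χ _ =>
    Real.rpow_nonneg (maxCharSum_nonneg χ) _
  have hcard : (S.card : ℝ) ≤ q.totient := by
    rw [← DirichletCharacter.card_eq_totient_of_hasEnoughRootsOfUnity ℂ q,
      Nat.card_eq_fintype_card]
    exact Nat.cast_le.2 (Finset.card_le_univ S)
  have h1 := Real.rpow_sum_le_const_mul_sum_rpow_of_nonneg S hp1 hM0
  have h2 : ∀ χ ∈ S, (maxCharSum χ ^ (2 * k)) ^ p = maxCharSum χ ^ (2 * (2 * L)) := by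
    intro χ _
    rw [← Real.rpow_mul (maxCharSum_nonneg χ), ← Real.rpow_natCast]
    congr 1
    rw [hp]
    push_cast
    field_simp
  rw [Finset.sum_congr rfl h2] at h1
  have h3 : (∑ χ ∈ S, maxCharSum χ ^ (2 * k)) ^ p ≤
      (q.totient * (Z ^ (2 * k) * (q : ℝ) ^ k)) ^ p := by
    calc (∑ χ ∈ S, maxCharSum χ ^ (2 * k)) ^ p
        ≤ (q.totient : ℝ) ^ (p - 1) *
            (q.totient * (q : ℝ) ^ (2 * L) * Z ^ (2 * (2 * L))) := by
          refine h1.trans (mul_le_mul ?_ ?_ (Finset.sum_nonneg fun χ _ =>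
            pow_nonneg (maxCharSum_nonneg χ) _) (by positivity))
          · exact Real.rpow_le_rpow (by positivity) hcard (by linarith)
          · exact hq
      _ = (q.totient : ℝ) ^ p * ((q : ℝ) ^ (2 * L) * Z ^ (2 * (2 * L))) := by
          rw [Real.rpow_sub_one hφ0.ne']
          field_simp
      _ = _ := by
          rw [Real.mul_rpow hφ0.le (by positivity), Real.mul_rpow (by positivity) (by positivity),
            ← Real.rpow_mul hZ0, ← Real.rpow_mul hq'.le, ← Real.rpow_natCast, ← Real.rpow_natCast,
            mul_comm (Z ^ _)]
          congr 3
          · rw [hp]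
            push_cast
            field_simp
          · rw [hp]
            push_cast
            field_simp
  have h4 := (Real.rpow_le_rpow_iff (Finset.sum_nonneg hM0) (by positivity) hp0).1 h3
  rw [moment, one_div, inv_mul_le_iff₀ hφ0]
  refine le_trans (le_of_eq ?_) h4
  congr!

end CharacterSums

/-! ### The choice of `C(k)` -/

theorem theorem1 :
    ∃ C E : ℝ → ℝ,
      E =O[𝓟 (Set.Ici 3)] (fun k : ℝ => k) ∧
      (∀ k : ℝ, 3 ≤ k →
        C k = Real.exp (4 * k * Real.log (Real.log k)
          + k * Real.log (Real.log (Real.log k)) + E k)) ∧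
      ∀ k : ℝ, 0 < k → ∀ ε : ℝ, 0 < ε → ∀ᶠ q : ℕ in atTop,
        CharacterSums.moment q k ≤ (C k + ε) * (q : ℝ) ^ k := by
  obtain ⟨D, hD, hmoment⟩ := CharacterSums.exists_moment_le
  -- The factor `9 * D` comes from `log (2 * L k) ≤ 3 * log k`. Subtracting the negative number `log
  -- log log 3` offsets the least value of `log log log k` on `k ≥ 3`.
  let A : ℝ := 2 * Real.log (9 * D) - Real.log (Real.log (Real.log 3))
  -- Adding 1 to the ceiling ensures `L k ≥ 2` even for small `k`.
  let L : ℝ → ℕ := fun k => ⌈k⌉₊ + 1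
  classical
  refine ⟨fun k => if 3 ≤ k then Real.exp (4 * k * Real.log (Real.log k)
      + k * Real.log (Real.log (Real.log k)) + A * k)
    else (D * Real.log (2 * L k : ℕ) ^ 2) ^ (2 * k), fun k => A * k,
    (isBigO_refl _ _).const_mul_left A, fun k hk => if_pos hk, fun k hk ε hε => ?_⟩
  have hL : 2 ≤ L k := Nat.succ_le_succ (Nat.ceil_pos.2 hk)
  have hkL : k ≤ 2 * L k := by
    have := Nat.le_ceil k
    simp only [L]
    push_cast
    linarith [Nat.cast_nonneg (α := ℝ) ⌈k⌉₊]
  filter_upwards [hmoment k hk (L k) hL hkL] with q hq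
  refine hq.trans (mul_le_mul_of_nonneg_right ?_ (by positivity))
  refine le_trans ?_ (le_add_of_nonneg_right hε.le)
  split_ifs with hk3
  · have hlogk : 1 < Real.log k := by
      rw [Real.lt_log_iff_exp_lt hk]
      linarith [Real.exp_one_lt_three]
    have hlog3 : 1 < Real.log 3 := by
      rw [Real.lt_log_iff_exp_lt (by norm_num)]
      exact Real.exp_one_lt_three
    have hlog3k : Real.log 3 ≤ Real.log k := Real.log_le_log (by norm_num) hk3
    have hlll : Real.log (Real.log (Real.log 3)) ≤ Real.log (Real.log (Real.log k)) :=
      Real.log_le_log (Real.log_pos hlog3) (Real.log_le_log (by linarith) hlog3k)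
    have hLk : ((2 * L k : ℕ) : ℝ) ≤ k ^ 3 := by
      have := Nat.ceil_lt_add_one hk.le
      simp only [L]
      push_cast
      nlinarith [mul_le_mul hk3 hk3 (by norm_num) hk.le]
    have hlogL : Real.log (2 * L k : ℕ) ≤ 3 * Real.log k := by
      have := Real.log_le_log (by positivity) hLk
      rwa [Real.log_pow] at this
    have hlogL0 : 0 ≤ Real.log (2 * L k : ℕ) := Real.log_natCast_nonneg _
    calc (D * Real.log (2 * L k : ℕ) ^ 2) ^ (2 * k)
        ≤ (D * (3 * Real.log k) ^ 2) ^ (2 * k) := by gcongr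
      _ = Real.exp (Real.log (9 * D * Real.log k ^ 2) * (2 * k)) := by
          rw [← Real.rpow_def_of_pos (by positivity)]
          congr 1
          ring
      _ ≤ _ := by
          rw [Real.exp_le_exp, Real.log_mul (by positivity) (by positivity), Real.log_pow]
          have := mul_le_mul_of_nonneg_left hlll hk.le
          simp only [A]
          push_cast
          linarith
  · exact le_rfl
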